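/- Let $K$ be a (strict) 2-category. A 1-arrow $j\colon u\to x$ of $K$ is *ff* if post-composition $K(z,u)\to K(z,x)$ with $j$ is fully faithful for every object $z$. Let $\mathsf{J}$ be a class of 1-arrows of $K$ such that: 1. $\mathsf{J}$ contains all identity 1-arrows and is closed under composition; for $j\colon u\to x$ in $\mathsf{J}$ and any $f\colon y\to x$ a strict pullback $y\times_x u$ (in the category underlying $K$) is specified, its projection to $y$ is again in $\mathsf{J}$, and the specified pullback of an identity arrow $\mathrm{id}_x$ along $f\colon y\to x$ is $\mathrm{id}_y$ (with $f$ as the other projection); 2. each $j\colon u\to x$ in $\mathsf{J}$ is strictly 2-regular: for all $f,g\colon x\to y$, every 2-arrow $\tilde a\colon f\circ j\Rightarrow g\circ j$ whose whiskerings with the two projections $u\times_x u\to u$ are equal is the whiskering with $j$ of a unique 2-arrow $a\colon f\Rightarrow g$; 3. each $j$ in $\mathsf{J}$ is ff. Let $K_\mathsf{J}$ be the following bicategory. Its objects are those of $K$. A 1-arrow $x\to y$ is a fraction $(j,f)$, i.e. a span $x\xleftarrow{j}u\xrightarrow{f}y$ with $j\in\mathsf{J}$; a 2-arrow $(j,f)\Rightarrow(k,g)$,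 with $k\colon v\to x$, is a 2-arrow $f\circ\mathrm{pr}_1\Rightarrow g\circ\mathrm{pr}_2\colon u\times_x v\to y$ of $K$. Call *canonical* the unique 2-arrow between two parallel arrows $a,b\colon t\to u$ with $ja=jb$ which $j$ sends to the identity. * The identity 2-arrow of $(j,f)$ is $f$ whiskered with the canonical $\mathrm{pr}_1\Rightarrow\mathrm{pr}_2\colon u\times_xu\to u$. The vertical composite of $t_1\colon(j_1,f_1)\Rightarrow(j_2,f_2)$ and $t_2\colon(j_2,f_2)\Rightarrow(j_3,f_3)$ is the unique 2-arrow on $u_1\times_xu_3$ whose restriction to $u_1\times_xu_2\times_xu_3$ is the composite of the restrictions of $t_1$ and $t_2$. * Fractions are composed by means of the specified pullbacks: $(j,f)$ from $x$ to $y$ followed by $(k,g)$ from $y$ to $z$ (with vertices $u$, $v$) is $x\leftarrow u\times_yv\to z$. The identity fraction is $(\mathrm{id}_x,\mathrm{id}_x)$. * Right whiskering of $t\colon(j_1,f_1)\Rightarrow(j_2,f_2)$ by $(l,h)$, $l\colon w\to y$: restrict $t$ to $(u_1\times_yw)\times_x(u_2\times_yw)$, lift it uniquely through $l$ to a 2-arrow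 between the projections to $w$, and whisker with $h$. * Left whiskering of $t\colon(k_1,g_1)\Rightarrow(k_2,g_2)$ (with vertices $v_1,v_2$ over $y$) by $(j,f)$ from $x$ to $y$ (with vertex $u$): it is the unique 2-arrow on $W=(u\times_yv_1)\times_x(u\times_yv_2)$ whose restriction along $M\times_xW\to W$, where $M=u\times_y(v_1\times_yv_2)$, is the restriction of $t$ along $M\to v_1\times_yv_2$, pre- and post-composed with the whiskered canonical 2-arrows comparing, over $x$, the arrows to $u\times_yv_i$ through $W$ and through $M$. * The associators and unitors are the 2-arrows induced by the canonical comparison arrows $r$ between vertices of iterated fractions, where an arrow $r\colon u\to v$ with $kr=j$, $gr=f$ induces the 2-arrow $(j,f)\Rightarrow(k,g)$ given by $g$ whiskered with the canonical $r\,\mathrm{pr}_1\Rightarrow\mathrm{pr}_2\colon u\times_xv\to v$. (A unitor is the identity whenever its comparison arrow is.) Let $A_\mathsf{J}\colon K\to K_\mathsf{J}$ be the identity on objects, send a 1-arrow $f\colon x\to y$ to the fraction $x\xleftarrow{\mathrm{id}_x}x\xrightarrow{f}y$, and send a 2-arrow $a\colon f\Rightarrow g$ to $a$ itself, regarded as a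 2-arrow on $x\times_xx=x$. Then $A_\mathsf{J}$ is a strict 2-functor: it preserves identity and composite 2-arrows, identity and composite 1-arrows, whiskerings, associators and unitors strictly, its comparison 2-arrows being identities. Moreover it is locally fully faithful: for all objects $x,y$ of $K$ the functor $K(x,y)\to K_\mathsf{J}(x,y)$ is fully faithful. -/

import Mathlib

open CategoryTheory Bicategory

universe w v u

namespace TwoSite

section Basic

variable {K : Type u} [Bicategory.{w, v} K] [Bicategory.Strict K]

/-- A 1-arrow `f : x ⟶ y` of a 2-category is *ff* (representably fully faithful) if postcomposition
`K(z, x) ⥤ K(z, y)` with `f` is fully faithful for every object `z`. -/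
def IsFF {x y : K} (f : x ⟶ y) : Prop :=
  ∀ ⦃z : K⦄ (g h : z ⟶ x) (b : g ≫ f ⟶ h ≫ f), ∃! a : g ⟶ h, a ▷ f = b

/-- A 1-arrow `p : u ⟶ x` with kernel pair `pr₁ pr₂ : e ⟶ u` is *strictly 2-regular* if every
2-arrow `a : p ≫ f ⟶ p ≫ g` whose whiskerings with `pr₁` and `pr₂` agree descends to a unique
2-arrow `f ⟶ g`. -/
def IsStrictlyTwoRegular {e u x : K} (p : u ⟶ x) (pr₁ pr₂ : e ⟶ u)
    (w : pr₁ ≫ p = pr₂ ≫ p) : Prop :=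
  ∀ ⦃y : K⦄ (f g : x ⟶ y) (a : p ≫ f ⟶ p ≫ g),
    pr₁ ◁ a = eqToHom (by rw [← Strict.assoc, w, Strict.assoc]) ≫ pr₂ ◁ a ≫
      eqToHom (by rw [← Strict.assoc, ← w, Strict.assoc]) →
    ∃! b : f ⟶ g, p ◁ b = a

/-- A strict pullback of `j` along `f`, in the category underlying the 2-category. -/
structure StrictPullback {u x y : K} (j : u ⟶ x) (f : y ⟶ x) where
  /-- the vertex -/
  pt : K
  /-- the projection that is the pullback of `j` along `f` -/
  fst : pt ⟶ y
  /-- the other projection -/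
  snd : pt ⟶ u
  isPullback : IsPullback fst snd f j

namespace StrictPullback

/-- The pullback of `𝟙 x` along `f : y ⟶ x` whose first projection is `𝟙 y`. -/
def ofId {x y : K} (f : y ⟶ x) : StrictPullback (𝟙 x) f where
  pt := y
  fst := 𝟙 y
  snd := f
  isPullback := IsPullback.id_horiz f

variable {u x y : K} {j : u ⟶ x} {f : y ⟶ x} (P : StrictPullback j f)

theorem w : P.fst ≫ f = P.snd ≫ j := P.isPullback.w

/-- The arrow into the pullback with given components. -/
noncomputable def lift {T : K} (a : T ⟶ y) (b : T ⟶ u) (h : a ≫ f = b ≫ j) : T ⟶ P.pt :=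
  P.isPullback.lift a b h

@[simp]
theorem lift_fst {T : K} (a : T ⟶ y) (b : T ⟶ u) (h : a ≫ f = b ≫ j) :
    P.lift a b h ≫ P.fst = a := P.isPullback.lift_fst a b h

@[simp]
theorem lift_snd {T : K} (a : T ⟶ y) (b : T ⟶ u) (h : a ≫ f = b ≫ j) :
    P.lift a b h ≫ P.snd = b := P.isPullback.lift_snd a b h

@[simp]
theorem lift_fst_assoc {T z : K} (a : T ⟶ y) (b : T ⟶ u) (h : a ≫ f = b ≫ j) (k : y ⟶ z) :
    P.lift a b h ≫ P.fst ≫ k = a ≫ k := by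
  rw [← Strict.assoc, P.lift_fst]

@[simp]
theorem lift_snd_assoc {T z : K} (a : T ⟶ y) (b : T ⟶ u) (h : a ≫ f = b ≫ j) (k : u ⟶ z) :
    P.lift a b h ≫ P.snd ≫ k = b ≫ k := by
  rw [← Strict.assoc, P.lift_snd]

theorem comp_w {T : K} (r : T ⟶ P.pt) : (r ≫ P.fst) ≫ f = (r ≫ P.snd) ≫ j := by
  rw [Strict.assoc, Strict.assoc, P.w]

theorem comp_lift_snd {R T z : K} (m : R ⟶ T) (a : T ⟶ y) (b : T ⟶ u) (h : a ≫ f = b ≫ j)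
    (k : u ⟶ z) : (m ≫ P.lift a b h) ≫ P.snd ≫ k = (m ≫ b) ≫ k := by
  rw [← Strict.assoc, Strict.assoc m, P.lift_snd]

end StrictPullback

/-- A singleton strict pretopology on a 2-category: a class of 1-arrows containing the identities
and closed under composition, with specified strict pullbacks which again lie in the class, and such
that the specified pullback of an identity 1-arrow is an identity 1-arrow. -/
structure StrictPretopology (K : Type u) [Bicategory.{w, v} K] [Bicategory.Strict K] where
  /-- the class of 1-arrows -/
  mem : ∀ ⦃x y : K⦄, (x ⟶ y) → Prop
  id_mem : ∀ x : K, mem (𝟙 x)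
  comp_mem : ∀ ⦃x y z : K⦄ (f : x ⟶ y) (g : y ⟶ z), mem f → mem g → mem (f ≫ g)
  /-- the specified pullback of `j` along `f` -/
  pullback : ∀ ⦃u x y : K⦄ (j : u ⟶ x) (_ : mem j) (f : y ⟶ x), StrictPullback j f
  pullback_mem : ∀ ⦃u x y : K⦄ (j : u ⟶ x) (hj : mem j) (f : y ⟶ x), mem (pullback j hj f).fst
  pullback_id : ∀ ⦃x y : K⦄ (f : y ⟶ x), pullback (𝟙 x) (id_mem x) f = StrictPullback.ofId f

/-- A strict subcanonical unary 2-site structure all of whose covers are ff: a singleton strict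
pretopology whose members are strictly 2-regular (that is, restriction along each member is fully
faithful into strict descent data) and ff. -/
structure StrictTwoSite (K : Type u) [Bicategory.{w, v} K] [Bicategory.Strict K] extends
    StrictPretopology K where
  subcanonical : ∀ ⦃u x : K⦄ (j : u ⟶ x) (hj : mem j),
    IsStrictlyTwoRegular j (pullback j hj j).fst (pullback j hj j).snd (pullback j hj j).w
  mem_ff : ∀ ⦃u x : K⦄ (j : u ⟶ x), mem j → IsFF j

/-- The unique lift of a 2-arrow through an ff 1-arrow. -/
noncomputable def IsFF.lift {x y z : K} {f : x ⟶ y} (hf : IsFF f) {g h : z ⟶ x}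
    (b : g ≫ f ⟶ h ≫ f) : g ⟶ h := (hf g h b).choose

theorem IsFF.lift_whisker {x y z : K} {f : x ⟶ y} (hf : IsFF f) {g h : z ⟶ x}
    (b : g ≫ f ⟶ h ≫ f) : hf.lift b ▷ f = b := (hf g h b).choose_spec.1

theorem IsFF.lift_eq {x y z : K} {f : x ⟶ y} (hf : IsFF f) {g h : z ⟶ x}
    {b : g ≫ f ⟶ h ≫ f} {a : g ⟶ h} (ha : a ▷ f = b) : hf.lift b = a :=
  ((hf g h b).choose_spec.2 a ha).symm

theorem IsFF.ext {x y z : K} {f : x ⟶ y} (hf : IsFF f) {g h : z ⟶ x}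
    {a a' : g ⟶ h} (ha : a ▷ f = a' ▷ f) : a = a' :=
  (hf g h _).unique ha rfl

/-- Precomposition with an ff and strictly 2-regular arrow is fully faithful. -/
theorem IsStrictlyTwoRegular.existsUnique {e u x y : K} {p : u ⟶ x} {pr₁ pr₂ : e ⟶ u}
    {w : pr₁ ≫ p = pr₂ ≫ p} (h : IsStrictlyTwoRegular p pr₁ pr₂ w) (hp : IsFF p)
    {f g : x ⟶ y} (a : p ≫ f ⟶ p ≫ g) : ∃! b : f ⟶ g, p ◁ b = a := by
  apply h
  obtain ⟨s, hs, -⟩ := hp pr₁ pr₂ (eqToHom w)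
  have e1 := whisker_exchange s a
  rw [whiskerRight_comp, whiskerRight_comp, hs] at e1
  simp only [Strict.associator_eqToIso, eqToIso.hom, eqToIso.inv, eqToHom_whiskerRight,
    eqToHom_trans] at e1
  rw [← Category.assoc (eqToHom _), ← e1]
  simp

namespace StrictTwoSite

variable (S : StrictTwoSite K)

theorem existsUnique_desc {u x y : K} {c : u ⟶ x} (hc : S.mem c) {f g : x ⟶ y}
    (a : c ≫ f ⟶ c ≫ g) : ∃! b : f ⟶ g, c ◁ b = a :=
  (S.subcanonical c hc).existsUnique (S.mem_ff c hc) a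

/-- Unique descent of a 2-arrow along a cover. -/
noncomputable def desc {u x y : K} {c : u ⟶ x} (hc : S.mem c) {f g : x ⟶ y}
    (a : c ≫ f ⟶ c ≫ g) : f ⟶ g := (S.existsUnique_desc hc a).choose

theorem whisker_desc {u x y : K} {c : u ⟶ x} (hc : S.mem c) {f g : x ⟶ y}
    (a : c ≫ f ⟶ c ≫ g) : c ◁ S.desc hc a = a := (S.existsUnique_desc hc a).choose_spec.1

variable {S} in
theorem cover_ext {u x y : K} {c : u ⟶ x} (hc : S.mem c) {f g : x ⟶ y} {a b : f ⟶ g}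
    (h : c ◁ a = c ◁ b) : a = b := (S.existsUnique_desc hc _).unique h rfl

/-- Gluing of a compatible family of local 2-arrows. -/
theorem glue {T y : K} {f g : T ⟶ y} (V : ∀ ⦃R : K⦄ (r : R ⟶ T), (r ≫ f ⟶ r ≫ g) → Prop)
    (uniq : ∀ ⦃R : K⦄ (r : R ⟶ T) (a b), V r a → V r b → a = b)
    (res : ∀ ⦃R R' : K⦄ (k : R' ⟶ R) (r : R ⟶ T) (a), V r a →
      V (k ≫ r) ((α_ k r f).hom ≫ k ◁ a ≫ (α_ k r g).inv))
    (loc : ∃ (R : K) (c : R ⟶ T) (a : _), S.mem c ∧ V c a) :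
    ∃! e : f ⟶ g, ∀ ⦃R : K⦄ (r : R ⟶ T) (a), V r a → r ◁ e = a := by
  obtain ⟨R, c, a, hc, ha⟩ := loc
  obtain ⟨e, he, -⟩ := S.existsUnique_desc hc a
  refine ⟨e, ?_, fun e' he' => cover_ext hc ((he' c a ha).trans he.symm)⟩
  intro R' r b hb
  let P := S.pullback c hc r
  apply cover_ext (S.pullback_mem c hc r)
  have h1 := res P.fst r b hb
  have h2 := res P.snd c a ha
  have key : ∀ (q : P.pt ⟶ T) (_ : P.fst ≫ r = q) (b'), V q b' → b' = q ◁ e := by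
    intro q hq b' hb'
    have hq2 : P.snd ≫ c = q := P.w.symm.trans hq
    subst hq2
    rw [uniq _ _ _ hb' h2, ← he]
    simp
  have h3 := key _ rfl _ h1
  rw [comp_whiskerLeft, cancel_epi, cancel_mono] at h3
  exact h3.symm

end StrictTwoSite

end Basic

section Fractions

variable {K : Type u} [Bicategory.{w, v} K] [Bicategory.Strict K]

/-- A fraction from `x` to `y`: a span `x ⟵ u ⟶ y` whose left leg is a cover. -/
structure Fraction (S : StrictTwoSite K) (x y : K) where
  /-- the vertex of the span -/
  apex : K
  /-- the left leg -/
  left : apex ⟶ x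
  left_mem : S.mem left
  /-- the right leg -/
  right : apex ⟶ y

variable {S : StrictTwoSite K}

namespace Fraction

variable {x y z : K}

theorem left_ff (F : Fraction S x y) : IsFF F.left := S.mem_ff _ F.left_mem

/-- The fraction `x ⟵ x ⟶ y` given by a 1-arrow, with left leg the identity. -/
@[reducible]
def ofArrow (S : StrictTwoSite K) {x y : K} (f : x ⟶ y) : Fraction S x y :=
  ⟨x, 𝟙 x, S.id_mem x, f⟩

/-- The fibre product `u ×ₓ v` of the vertices of two fractions out of `x`. -/
def overlap (F : Fraction S x y) (G : Fraction S x z) : StrictPullback G.left F.left :=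
  S.pullback G.left G.left_mem F.left

/-- The composite span, formed with the specified pullback. -/
@[reducible]
def comp (F : Fraction S x y) (G : Fraction S y z) : Fraction S x z where
  apex := (S.pullback G.left G.left_mem F.right).pt
  left := (S.pullback G.left G.left_mem F.right).fst ≫ F.left
  left_mem := S.comp_mem _ _ (S.pullback_mem _ _ _) F.left_mem
  right := (S.pullback G.left G.left_mem F.right).snd ≫ G.right

/-- A map of fractions from `x ⟵ u ⟶ y` to `x ⟵ v ⟶ y`: a 2-arrow between the two arrows
`u ×ₓ v ⟶ y`. -/
@[ext]
structure Hom (F G : Fraction S x y) where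
  /-- the 2-arrow -/
  cell : (F.overlap G).fst ≫ F.right ⟶ (F.overlap G).snd ≫ G.right

/-- The restriction of a map of fractions along the arrow `T ⟶ u ×ₓ v` with components `a`, `b`. -/
noncomputable def Hom.at {F G : Fraction S x y} (t : Hom F G) {T : K} (a : T ⟶ F.apex)
    (b : T ⟶ G.apex) (h : a ≫ F.left = b ≫ G.left) : a ≫ F.right ⟶ b ≫ G.right :=
  eqToHom (by rw [← Strict.assoc, StrictPullback.lift_fst]) ≫
    (F.overlap G).lift a b h ◁ t.cell ≫
    eqToHom (by rw [← Strict.assoc, StrictPullback.lift_snd])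

/-- The identity map: the canonical 2-arrow `pr₁ ⟶ pr₂ : u ×ₓ u ⟶ u` over `x`, whiskered with the
right leg. -/
noncomputable def Hom.id (F : Fraction S x y) : Hom F F where
  cell := F.left_ff.lift (eqToHom (F.overlap F).w) ▷ F.right

/-- Vertical composition: the 2-arrow `t₁ ⊕ t₂` on `u₁ ×ₓ u₂ ×ₓ u₃`, descended along the projection
to `u₁ ×ₓ u₃`. -/
noncomputable def Hom.comp {F₁ F₂ F₃ : Fraction S x y} (t₁ : Hom F₁ F₂) (t₂ : Hom F₂ F₃) :
    Hom F₁ F₃ where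
  cell :=
    let W := F₁.overlap F₃
    let Q := S.pullback F₂.left F₂.left_mem (W.fst ≫ F₁.left)
    S.desc (S.pullback_mem F₂.left F₂.left_mem (W.fst ≫ F₁.left))
      (eqToHom (Strict.assoc _ _ _).symm ≫
        t₁.at (Q.fst ≫ W.fst) Q.snd (by rw [Strict.assoc, Q.w]) ≫
        t₂.at Q.snd (Q.fst ≫ W.snd) (by rw [Strict.assoc, ← W.w, Q.w]) ≫
        eqToHom (Strict.assoc _ _ _))

/-- The map of fractions associated with a renaming map `(r, a)`. -/
noncomputable def Hom.renaming {F G : Fraction S x y} (r : F.apex ⟶ G.apex)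
    (hr : r ≫ G.left = F.left) (a : F.right ⟶ r ≫ G.right) : Hom F G where
  cell :=
    let W := F.overlap G
    W.fst ◁ a ≫ eqToHom (Strict.assoc _ _ _).symm ≫
      G.left_ff.lift (eqToHom (by rw [Strict.assoc, hr, W.w]) :
        (W.fst ≫ r) ≫ G.left ⟶ W.snd ≫ G.left) ▷ G.right

/-- Right whiskering of a map of fractions `t : F ⟶ G` by `H`. The source of the 2-arrow is the
fibre product of the vertices of `F.comp H` and `G.comp H`; the 2-arrow is the unique lift of the
restriction of `t` through the left leg of `H`, whiskered with the right leg of `H`. -/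
noncomputable def Hom.whiskerRight {F G : Fraction S x y} (t : Hom F G) (H : Fraction S y z) :
    Hom (F.comp H) (G.comp H) where
  cell :=
    let A := S.pullback H.left H.left_mem F.right
    let B := S.pullback H.left H.left_mem G.right
    let W : StrictPullback (B.fst ≫ G.left) (A.fst ≫ F.left) := (F.comp H).overlap (G.comp H)
    eqToHom (Strict.assoc _ _ _).symm ≫
      H.left_ff.lift
        (eqToHom (A.comp_w _).symm ≫
          t.at (W.fst ≫ A.fst) (W.snd ≫ B.fst) (by rw [Strict.assoc, W.w, Strict.assoc]) ≫
          eqToHom (B.comp_w _) :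
        (W.fst ≫ A.snd) ≫ H.left ⟶ (W.snd ≫ B.snd) ≫ H.left) ▷ H.right ≫
      eqToHom (Strict.assoc _ _ _)

/-- Left whiskering of a map of fractions `t : G ⟶ H` by `F = (x ⟵ u ⟶ y)`. Write `v₁`, `v₂` for
the vertices of `G`, `H`, let `W = (u ×_y v₁) ×ₓ (u ×_y v₂)` and `M = u ×_y (v₁ ×_y v₂)`. The
2-arrow on `W` is descended along the projection `C = M ×ₓ W ⟶ W` from the composite of
the canonical 2-arrow over `x` from `C ⟶ W ⟶ u ×_y v₁` to `C ⟶ M ⟶ u ×_y v₁`, the restriction of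
`t` along `C ⟶ M ⟶ v₁ ×_y v₂`, and the canonical 2-arrow over `x` from `C ⟶ M ⟶ u ×_y v₂` to
`C ⟶ W ⟶ u ×_y v₂`. -/
noncomputable def Hom.whiskerLeft (F : Fraction S x y) {G H : Fraction S y z} (t : Hom G H) :
    Hom (F.comp G) (F.comp H) where
  cell :=
    let A := S.pullback G.left G.left_mem F.right
    let B := S.pullback H.left H.left_mem F.right
    let W : StrictPullback (B.fst ≫ F.left) (A.fst ≫ F.left) := (F.comp G).overlap (F.comp H)
    let N := G.overlap H
    have hN : S.mem (N.fst ≫ G.left) := S.comp_mem _ _ (S.pullback_mem _ _ _) G.left_mem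
    let M := S.pullback (N.fst ≫ G.left) hN F.right
    have hM : S.mem (M.fst ≫ F.left) := S.comp_mem _ _ (S.pullback_mem _ _ _) F.left_mem
    let C := S.pullback (M.fst ≫ F.left) hM (W.fst ≫ A.fst ≫ F.left)
    let mA : M.pt ⟶ A.pt := A.lift M.fst (M.snd ≫ N.fst) (by rw [M.w, Strict.assoc])
    let mB : M.pt ⟶ B.pt := B.lift M.fst (M.snd ≫ N.snd)
      (by rw [M.w, Strict.assoc, ← N.w])
    let sA : C.fst ≫ W.fst ⟶ C.snd ≫ mA := (F.comp G).left_ff.lift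
      (eqToHom (by
        change (C.fst ≫ W.fst) ≫ A.fst ≫ F.left = (C.snd ≫ mA) ≫ A.fst ≫ F.left
        rw [Strict.assoc, C.w, Strict.assoc, ← Strict.assoc mA, A.lift_fst]))
    let sB : C.snd ≫ mB ⟶ C.fst ≫ W.snd := (F.comp H).left_ff.lift
      (eqToHom (by
        change (C.snd ≫ mB) ≫ B.fst ≫ F.left = (C.fst ≫ W.snd) ≫ B.fst ≫ F.left
        rw [Strict.assoc, Strict.assoc, ← W.w, C.w, ← Strict.assoc mB, B.lift_fst]))
    S.desc (S.pullback_mem _ hM (W.fst ≫ A.fst ≫ F.left))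
      (eqToHom (Strict.assoc _ _ _).symm ≫ sA ▷ (A.snd ≫ G.right) ≫
        eqToHom (A.comp_lift_snd _ _ _ _ _) ≫
        t.at (C.snd ≫ M.snd ≫ N.fst) (C.snd ≫ M.snd ≫ N.snd)
          (by simp only [Strict.assoc, N.w]) ≫
        eqToHom (B.comp_lift_snd _ _ _ _ _).symm ≫
        sB ▷ (B.snd ≫ H.right) ≫ eqToHom (Strict.assoc _ _ _))

end Fraction

end Fractions

section Calculus

variable {K : Type u} [Bicategory.{w, v} K] [Bicategory.Strict K] {S : StrictTwoSite K}

attribute [local simp] Strict.associator_eqToIso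

namespace Fraction

variable {x y z : K}

/-- `a : T ⟶ u` is a generalised element of a fraction `x ⟵ u ⟶ y`, with images `p` and `q` in `x`
and `y`. -/
structure Pt (F : Fraction S x y) {T : K} (a : T ⟶ F.apex) (p : T ⟶ x) (q : T ⟶ y) : Prop where
  hb : a ≫ F.left = p
  ho : a ≫ F.right = q

namespace Pt

variable {F : Fraction S x y} {T R : K} {a a' a'' : T ⟶ F.apex} {p p' p'' : T ⟶ x}
  {q q' q'' : T ⟶ y}

/-- Restriction of an element. -/
theorem res (r : R ⟶ T) (P : F.Pt a p q) : F.Pt (r ≫ a) (r ≫ p) (r ≫ q) where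
  hb := by rw [Strict.assoc, P.hb]
  ho := by rw [Strict.assoc, P.ho]

/-- The action of a 2-arrow in the base on elements. -/
noncomputable def move (P : F.Pt a p q) (Q : F.Pt a' p' q') (θ : p ⟶ p') : q ⟶ q' :=
  eqToHom P.ho.symm ≫ F.left_ff.lift (eqToHom P.hb ≫ θ ≫ eqToHom Q.hb.symm) ▷ F.right ≫
    eqToHom Q.ho

theorem move_eq {P : F.Pt a p q} {Q : F.Pt a' p' q'} {θ : p ⟶ p'} (s : a ⟶ a')
    (h : s ▷ F.left = eqToHom P.hb ≫ θ ≫ eqToHom Q.hb.symm) :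
    P.move Q θ = eqToHom P.ho.symm ≫ s ▷ F.right ≫ eqToHom Q.ho := by
  rw [move, F.left_ff.lift_eq h]

theorem exists_lift (P : F.Pt a p q) (Q : F.Pt a' p' q') (θ : p ⟶ p') : ∃ s : a ⟶ a',
    s ▷ F.left = eqToHom P.hb ≫ θ ≫ eqToHom Q.hb.symm := ⟨_, F.left_ff.lift_whisker _⟩

@[simp]
theorem move_id (P : F.Pt a p q) (Q : F.Pt a p q) : P.move Q (𝟙 _) = 𝟙 _ := by
  rw [move_eq (𝟙 _)] <;> simp

@[simp]
theorem move_move (P : F.Pt a p q) (Q : F.Pt a' p' q') (Q' : F.Pt a' p' q')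
    (R : F.Pt a'' p'' q'') (θ : p ⟶ p')
    (θ' : p' ⟶ p'') : P.move Q θ ≫ Q'.move R θ' = P.move R (θ ≫ θ') := by
  obtain ⟨s, hs⟩ := exists_lift P Q θ
  obtain ⟨s', hs'⟩ := exists_lift Q R θ'
  rw [move_eq s hs, move_eq s' hs', move_eq (s ≫ s') (by simp [hs, hs'])]
  simp

@[simp]
theorem move_move_assoc (P : F.Pt a p q) (Q : F.Pt a' p' q') (Q' : F.Pt a' p' q')
    (R : F.Pt a'' p'' q'') (θ : p ⟶ p') (θ' : p' ⟶ p'') {s : T ⟶ y} (e : q'' ⟶ s) :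
    P.move Q θ ≫ Q'.move R θ' ≫ e = P.move R (θ ≫ θ') ≫ e := by
  rw [← Category.assoc, move_move]

theorem res_move (r : R ⟶ T) (P : F.Pt a p q) (Q : F.Pt a' p' q') (θ : p ⟶ p') :
    r ◁ P.move Q θ = (P.res r).move (Q.res r) (r ◁ θ) := by
  obtain ⟨s, hs⟩ := exists_lift P Q θ
  rw [move_eq s hs, move_eq (r ◁ s) (by simp [hs])]
  simp

/-- Two restrictions of an element along 2-isomorphic arrows. -/
theorem whiskerRight_out {r r' : R ⟶ T} (s : r ⟶ r') (P : F.Pt a p q) :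
    s ▷ q = (P.res r).move (P.res r') (s ▷ p) := by
  obtain ⟨rfl, rfl⟩ := P
  rw [move_eq (s ▷ a)] <;> simp

/-- Elements with the same underlying arrow. -/
theorem move_eqToHom {P : F.Pt a p q} {Q : F.Pt a' p' q'} (h : a = a') (hp : p = p') :
    P.move Q (eqToHom hp) = eqToHom (by rw [← P.ho, ← Q.ho, h]) := by
  rw [move_eq (eqToHom h)] <;> simp

/-- Changing the names of the arrows underlying elements. -/
theorem move_congr {a₁ a₁' : T ⟶ F.apex} {p₁ p₁' : T ⟶ x} {q₁ q₁' : T ⟶ y} (P : F.Pt a p q)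
    (P₁ : F.Pt a₁ p₁ q₁) (Q : F.Pt a' p' q') (Q₁ : F.Pt a₁' p₁' q₁') (ha : a = a₁) (hb : a' = a₁')
    (θ : p ⟶ p') :
    P.move Q θ = eqToHom (by rw [← P.ho, ha, P₁.ho]) ≫
      P₁.move Q₁ (eqToHom (by rw [← P.hb, ha, P₁.hb]) ≫ θ ≫
        eqToHom (by rw [← Q.hb, hb, Q₁.hb])) ≫ eqToHom (by rw [← Q.ho, hb, Q₁.ho]) := by
  subst ha hb
  obtain ⟨rfl, rfl⟩ := P
  obtain ⟨rfl, rfl⟩ := P₁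
  obtain ⟨rfl, rfl⟩ := Q
  obtain ⟨rfl, rfl⟩ := Q₁
  simp

end Pt

/-- The two tautological elements over the overlap. -/
theorem ptL (F G : Fraction S x y) :
    F.Pt (F.overlap G).fst ((F.overlap G).fst ≫ F.left) ((F.overlap G).fst ≫ F.right) :=
  ⟨rfl, rfl⟩

theorem ptR (F G : Fraction S x y) :
    G.Pt (F.overlap G).snd ((F.overlap G).fst ≫ F.left) ((F.overlap G).snd ≫ G.right) :=
  ⟨(F.overlap G).w.symm, rfl⟩

/-- Local elements exist. -/
theorem exists_cover (F : Fraction S x z) {T : K} (p : T ⟶ x) : ∃ (R : K) (c : R ⟶ T)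
    (a : R ⟶ F.apex), S.mem c ∧ F.Pt a (c ≫ p) (a ≫ F.right) :=
  ⟨_, (S.pullback F.left F.left_mem p).fst, _, S.pullback_mem _ _ _,
    (S.pullback F.left F.left_mem p).w.symm, rfl⟩

namespace Hom

variable {F G H : Fraction S x y} {T R : K} {p p' p'' : T ⟶ x} {q q' q'' : T ⟶ y}
  {a : T ⟶ F.apex} {b : T ⟶ G.apex} {c : T ⟶ H.apex}

/-- Two restrictions of a map of fractions are compatible. -/
theorem cell_compat (t : Hom F G) (l l' : T ⟶ (F.overlap G).pt)
    (θ : l ≫ (F.overlap G).fst ≫ F.left ⟶ l' ≫ (F.overlap G).fst ≫ F.left) :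
    l ◁ t.cell ≫ ((F.ptR G).res l).move ((F.ptR G).res l') θ =
      ((F.ptL G).res l).move ((F.ptL G).res l') θ ≫ l' ◁ t.cell := by
  have hff : IsFF ((F.overlap G).fst ≫ F.left) :=
    S.mem_ff _ (S.comp_mem _ _ (S.pullback_mem _ _ _) F.left_mem)
  obtain ⟨s, hs, -⟩ := hff l l' θ
  subst hs
  rw [← Pt.whiskerRight_out s (F.ptR G), ← Pt.whiskerRight_out s (F.ptL G), whisker_exchange]

/-- The relation `e = t(P, Q, θ)`, for elements `P` of `F` and `Q` of `G` and a 2-arrow `θ` between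
their images in `x`. -/
def IsVal (t : Hom F G) (P : F.Pt a p q) (Q : G.Pt b p' q') (θ : p ⟶ p') (e : q ⟶ q') : Prop :=
  ∀ ⦃R : K⦄ (r : R ⟶ T) (l : R ⟶ (F.overlap G).pt)
    (θ₁ : r ≫ p ⟶ l ≫ (F.overlap G).fst ≫ F.left)
    (θ₂ : l ≫ (F.overlap G).fst ≫ F.left ⟶ r ≫ p'), θ₁ ≫ θ₂ = r ◁ θ →
    r ◁ e = (P.res r).move ((F.ptL G).res l) θ₁ ≫ l ◁ t.cell ≫
      ((F.ptR G).res l).move (Q.res r) θ₂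

theorem val_res {t : Hom F G} {P : F.Pt a p q} {Q : G.Pt b p' q'}
    {R' : K} (k : R' ⟶ R) (r : R ⟶ T) (l : R ⟶ (F.overlap G).pt)
    (θ₁ : r ≫ p ⟶ l ≫ (F.overlap G).fst ≫ F.left)
    (θ₂ : l ≫ (F.overlap G).fst ≫ F.left ⟶ r ≫ p') :
    (P.res (k ≫ r)).move ((F.ptL G).res (k ≫ l)) ((α_ _ _ _).hom ≫ k ◁ θ₁ ≫ (α_ _ _ _).inv) ≫
      (k ≫ l) ◁ t.cell ≫
      ((F.ptR G).res (k ≫ l)).move (Q.res (k ≫ r)) ((α_ _ _ _).hom ≫ k ◁ θ₂ ≫ (α_ _ _ _).inv) =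
    (α_ _ _ _).hom ≫ k ◁ ((P.res r).move ((F.ptL G).res l) θ₁ ≫ l ◁ t.cell ≫
      ((F.ptR G).res l).move (Q.res r) θ₂) ≫ (α_ _ _ _).inv := by
  rw [← Pt.move_move _ ((P.res r).res k) ((P.res r).res k),
    ← Pt.move_move _ (((F.ptL G).res l).res k) (((F.ptL G).res l).res k),
    ← Pt.move_move _ (((F.ptR G).res l).res k) (((F.ptR G).res l).res k),
    ← Pt.move_move _ ((Q.res r).res k) ((Q.res r).res k),
    ← Pt.res_move k (P.res r) ((F.ptL G).res l), ← Pt.res_move k ((F.ptR G).res l) (Q.res r)]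
  simp [Pt.move_eqToHom]

theorem val_indep {t : Hom F G} {P : F.Pt a p q} {Q : G.Pt b p' q'}
    {l l' : T ⟶ (F.overlap G).pt}
    (θ₁ : p ⟶ l ≫ (F.overlap G).fst ≫ F.left) (θ₂ : l ≫ (F.overlap G).fst ≫ F.left ⟶ p')
    (θ₁' : p ⟶ l' ≫ (F.overlap G).fst ≫ F.left) (θ₂' : l' ≫ (F.overlap G).fst ≫ F.left ⟶ p')
    [IsIso θ₂'] (h : θ₁ ≫ θ₂ = θ₁' ≫ θ₂') :
    P.move ((F.ptL G).res l) θ₁ ≫ l ◁ t.cell ≫ ((F.ptR G).res l).move Q θ₂ =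
      P.move ((F.ptL G).res l') θ₁' ≫ l' ◁ t.cell ≫ ((F.ptR G).res l').move Q θ₂' := by
  obtain rfl : θ₁' = θ₁ ≫ θ₂ ≫ inv θ₂' := by simp [← Category.assoc, h]
  have := congrArg (· ≫ ((F.ptR G).res l').move Q θ₂') (t.cell_compat l l' (θ₂ ≫ inv θ₂'))
  rw [Category.assoc, Category.assoc] at this
  rw [← Pt.move_move _ ((F.ptL G).res l) ((F.ptL G).res l), Category.assoc, ← this]
  simp

theorem existsUnique_val (t : Hom F G) (P : F.Pt a p q) (Q : G.Pt b p' q') (θ : p ⟶ p') :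
    ∃! e : q ⟶ q', IsVal t P Q θ e := by
  have := S.glue (f := q) (g := q') (fun R r e ↦ ∃ (l : R ⟶ (F.overlap G).pt)
    (θ₁ : r ≫ p ⟶ l ≫ (F.overlap G).fst ≫ F.left)
    (θ₂ : l ≫ (F.overlap G).fst ≫ F.left ⟶ r ≫ p'), θ₁ ≫ θ₂ = r ◁ θ ∧
    e = (P.res r).move ((F.ptL G).res l) θ₁ ≫ l ◁ t.cell ≫
      ((F.ptR G).res l).move (Q.res r) θ₂) ?_ ?_ ?_
  · obtain ⟨e, he, hu⟩ := this
    exact ⟨e, fun R r l θ₁ θ₂ h ↦ he r _ ⟨l, θ₁, θ₂, h, rfl⟩,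
      fun e' he' ↦ hu e' fun R r a ⟨l, θ₁, θ₂, h, ha⟩ ↦ (he' r l θ₁ θ₂ h).trans ha.symm⟩
  · rintro R r _ _ ⟨l, θ₁, θ₂, h, rfl⟩ ⟨l', θ₁', θ₂', h', rfl⟩
    obtain ⟨R', c, m, hc, hm⟩ := exists_cover F (r ≫ p')
    apply StrictTwoSite.cover_ext hc
    have e1 : (F.overlap G).lift m (c ≫ r ≫ b) (by rw [hm.hb, Strict.assoc, Strict.assoc, Q.hb]) ≫
        (F.overlap G).fst ≫ F.left = (c ≫ r) ≫ p' := by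
      rw [← Strict.assoc, StrictPullback.lift_fst, hm.hb, Strict.assoc]
    have e2 := val_res (t := t) (P := P) (Q := Q) c r l θ₁ θ₂
    have e3 := val_res (t := t) (P := P) (Q := Q) c r l' θ₁' θ₂'
    have e4 : ((α_ _ _ _).hom ≫ c ◁ θ₁ ≫ (α_ _ _ _).inv) ≫
        ((α_ _ _ _).hom ≫ c ◁ θ₂ ≫ (α_ _ _ _).inv) = (c ≫ r) ◁ θ ≫ eqToHom e1.symm ≫
          eqToHom e1 := by
      have := congrArg (c ◁ ·) h
      simp only [whiskerLeft_comp] at this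
      rw [comp_whiskerLeft, ← this]
      simp
    have e5 : ((α_ _ _ _).hom ≫ c ◁ θ₁' ≫ (α_ _ _ _).inv) ≫
        ((α_ _ _ _).hom ≫ c ◁ θ₂' ≫ (α_ _ _ _).inv) = (c ≫ r) ◁ θ ≫ eqToHom e1.symm ≫
          eqToHom e1 := by
      have := congrArg (c ◁ ·) h'
      simp only [whiskerLeft_comp] at this
      rw [comp_whiskerLeft, ← this]
      simp
    rw [← Category.assoc ((c ≫ r) ◁ θ)] at e4 e5
    rw [val_indep _ _ _ _ e4] at e2
    rw [val_indep _ _ _ _ e5] at e3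
    have := e2.symm.trans e3
    rwa [cancel_epi, cancel_mono] at this
  · rintro R R' k r _ ⟨l, θ₁, θ₂, h, rfl⟩
    refine ⟨k ≫ l, (α_ _ _ _).hom ≫ k ◁ θ₁ ≫ (α_ _ _ _).inv, (α_ _ _ _).hom ≫ k ◁ θ₂ ≫ (α_ _ _ _).inv, ?_, ?_⟩
    · have := congrArg (k ◁ ·) h
      simp only [whiskerLeft_comp] at this
      rw [comp_whiskerLeft, ← this]
      simp
    · rw [val_res (P := P) (Q := Q)]
  · obtain ⟨R, c, a, hc, ha⟩ := exists_cover F p'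
    refine ⟨R, c, _, hc, (F.overlap G).lift a (c ≫ b) ?_, c ◁ θ ≫ eqToHom ?_, eqToHom ?_, ?_, rfl⟩
    · rw [ha.hb, Strict.assoc, Q.hb]
    · rw [← Strict.assoc, StrictPullback.lift_fst, ha.hb]
    · rw [← Strict.assoc, StrictPullback.lift_fst, ha.hb]
    · simp

/-- The 2-arrow `t(P, Q, θ)` obtained from a map of fractions `t : F ⟶ G`, elements `P` of `F` and
`Q` of `G` and a 2-arrow `θ` between their images in `x`. -/
noncomputable def eval (t : Hom F G) (P : F.Pt a p q) (Q : G.Pt b p' q') (θ : p ⟶ p') : q ⟶ q' :=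
  (existsUnique_val t P Q θ).choose

theorem eval_isVal (t : Hom F G) (P : F.Pt a p q) (Q : G.Pt b p' q') (θ : p ⟶ p') :
    IsVal t P Q θ (t.eval P Q θ) := (existsUnique_val t P Q θ).choose_spec.1

theorem eval_eq (t : Hom F G) {P : F.Pt a p q} {Q : G.Pt b p' q'} {θ : p ⟶ p'} {e : q ⟶ q'}
    (h : IsVal t P Q θ e) : t.eval P Q θ = e := ((existsUnique_val t P Q θ).choose_spec.2 e h).symm

theorem eval_formula (t : Hom F G) (P : F.Pt a p q) (Q : G.Pt b p' q')
    (l : T ⟶ (F.overlap G).pt) (θ₁ : p ⟶ l ≫ (F.overlap G).fst ≫ F.left)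
    (θ₂ : l ≫ (F.overlap G).fst ≫ F.left ⟶ p') :
    t.eval P Q (θ₁ ≫ θ₂) =
      P.move ((F.ptL G).res l) θ₁ ≫ l ◁ t.cell ≫ ((F.ptR G).res l).move Q θ₂ := by
  have h := t.eval_isVal P Q (θ₁ ≫ θ₂) (𝟙 T) l ((λ_ _).hom ≫ θ₁) (θ₂ ≫ (λ_ _).inv) (by simp)
  rw [← Pt.move_move _ P P, ← Pt.move_move _ Q Q, Strict.leftUnitor_eqToIso,
    Strict.leftUnitor_eqToIso, eqToIso.hom, eqToIso.inv, Pt.move_eqToHom (Strict.id_comp a),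
    Pt.move_eqToHom (Strict.id_comp b).symm, id_whiskerLeft, Strict.leftUnitor_eqToIso,
    Strict.leftUnitor_eqToIso, eqToIso.hom, eqToIso.inv, Category.assoc, cancel_epi] at h
  refine (cancel_mono (eqToHom (Strict.id_comp q').symm)).1 ?_
  simpa using h

theorem res_eval (r : R ⟶ T) (t : Hom F G) (P : F.Pt a p q) (Q : G.Pt b p' q') (θ : p ⟶ p') :
    r ◁ t.eval P Q θ = t.eval (P.res r) (Q.res r) (r ◁ θ) := by
  refine (t.eval_eq ?_).symm
  intro R' k l θ₁ θ₂ h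
  have := t.eval_isVal P Q θ (k ≫ r) l ((α_ _ _ _).hom ≫ θ₁) (θ₂ ≫ (α_ _ _ _).inv) (by
    rw [comp_whiskerLeft, ← h]; simp)
  rw [comp_whiskerLeft, ← Pt.move_move _ ((P.res r).res k) ((P.res r).res k),
    ← Pt.move_move _ ((Q.res r).res k) ((Q.res r).res k)] at this
  simp only [Strict.associator_eqToIso, eqToIso.hom, eqToIso.inv] at this
  rw [Pt.move_eqToHom (Strict.assoc _ _ _), Pt.move_eqToHom (Strict.assoc _ _ _).symm] at this
  refine (cancel_epi (eqToHom (Strict.assoc k r q))).1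
    ((cancel_mono (eqToHom (Strict.assoc k r q').symm)).1 ?_)
  simpa using this

theorem exists_formula (F : Fraction S x y) (Q : G.Pt b p' q') : ∃ (R : K) (c : R ⟶ T)
    (l : R ⟶ (F.overlap G).pt) (_ : l ≫ (F.overlap G).fst ≫ F.left = c ≫ p'), S.mem c := by
  obtain ⟨R, c, a, hc, ha⟩ := exists_cover F p'
  refine ⟨R, c, (F.overlap G).lift a (c ≫ b) ?_, ?_, hc⟩
  · rw [ha.hb, Strict.assoc, Q.hb]
  · rw [← Strict.assoc, StrictPullback.lift_fst, ha.hb]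

@[simp]
theorem move_eval (t : Hom F G) {a' : T ⟶ F.apex} (P : F.Pt a p q) (P₁ P₂ : F.Pt a' p' q')
    (Q : G.Pt b p'' q'') (φ : p ⟶ p') (θ : p' ⟶ p'') :
    P.move P₁ φ ≫ t.eval P₂ Q θ = t.eval P Q (φ ≫ θ) := by
  obtain ⟨R, c, l, hl, hc⟩ := exists_formula F Q
  apply StrictTwoSite.cover_ext hc
  have e1 : c ◁ θ = (c ◁ θ ≫ eqToHom hl.symm) ≫ eqToHom hl := by simp
  have e2 : c ◁ (φ ≫ θ) = (c ◁ φ ≫ c ◁ θ ≫ eqToHom hl.symm) ≫ eqToHom hl := by simp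
  rw [whiskerLeft_comp, res_eval, res_eval, e1, e2, eval_formula, eval_formula, Pt.res_move]
  simp

@[simp]
theorem move_eval_assoc (t : Hom F G) {a' : T ⟶ F.apex} (P : F.Pt a p q) (P₁ P₂ : F.Pt a' p' q')
    (Q : G.Pt b p'' q'') (φ : p ⟶ p') (θ : p' ⟶ p'') {s : T ⟶ y} (e : q'' ⟶ s) :
    P.move P₁ φ ≫ t.eval P₂ Q θ ≫ e = t.eval P Q (φ ≫ θ) ≫ e := by
  rw [← Category.assoc, move_eval]

@[simp]
theorem eval_move (t : Hom F G) {b' : T ⟶ G.apex} (P : F.Pt a p q) (Q₁ Q₂ : G.Pt b p' q')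
    (Q : G.Pt b' p'' q'') (φ : p ⟶ p') (θ : p' ⟶ p'') :
    t.eval P Q₁ φ ≫ Q₂.move Q θ = t.eval P Q (φ ≫ θ) := by
  obtain ⟨R, c, l, hl, hc⟩ := exists_formula F Q₁
  apply StrictTwoSite.cover_ext hc
  have e1 : c ◁ φ = (c ◁ φ ≫ eqToHom hl.symm) ≫ eqToHom hl := by simp
  have e2 : c ◁ (φ ≫ θ) = (c ◁ φ ≫ eqToHom hl.symm) ≫ eqToHom hl ≫ c ◁ θ := by simp
  rw [whiskerLeft_comp, res_eval, res_eval, e1, e2, eval_formula, eval_formula, Pt.res_move]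
  simp

@[simp]
theorem eval_move_assoc (t : Hom F G) {b' : T ⟶ G.apex} (P : F.Pt a p q) (Q₁ Q₂ : G.Pt b p' q')
    (Q : G.Pt b' p'' q'') (φ : p ⟶ p') (θ : p' ⟶ p'') {s : T ⟶ y} (e : q'' ⟶ s) :
    t.eval P Q₁ φ ≫ Q₂.move Q θ ≫ e = t.eval P Q (φ ≫ θ) ≫ e := by
  rw [← Category.assoc, eval_move]

theorem eval_cell (t : Hom F G) : t.eval (F.ptL G) (F.ptR G) (𝟙 _) = t.cell := by
  have := t.eval_formula (F.ptL G) (F.ptR G) (𝟙 _) (λ_ _).inv (λ_ _).hom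
  rw [Iso.inv_hom_id] at this
  rw [this, Strict.leftUnitor_eqToIso, eqToIso.hom, eqToIso.inv,
    Pt.move_eqToHom (Strict.id_comp _).symm, Pt.move_eqToHom (Strict.id_comp _)]
  simp [Strict.leftUnitor_eqToIso]

theorem ext_eval {t t' : Hom F G} (h : ∀ ⦃T : K⦄ ⦃a : T ⟶ F.apex⦄ ⦃b : T ⟶ G.apex⦄
    ⦃p p' : T ⟶ x⦄ ⦃q q' : T ⟶ y⦄ (P : F.Pt a p q) (Q : G.Pt b p' q') (θ : p ⟶ p'),
    t.eval P Q θ = t'.eval P Q θ) : t = t' := by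
  ext
  rw [← eval_cell, ← eval_cell, h]

theorem eval_at (t : Hom F G) (h : a ≫ F.left = b ≫ G.left) :
    t.at a b h = t.eval (p := a ≫ F.left) (p' := a ≫ F.left) ⟨rfl, rfl⟩ ⟨h.symm, rfl⟩ (𝟙 _) := by
  have e : (F.overlap G).lift a b h ≫ (F.overlap G).fst ≫ F.left = a ≫ F.left := by
    rw [← Strict.assoc, StrictPullback.lift_fst]
  have := t.eval_formula (p := a ≫ F.left) (p' := a ≫ F.left) ⟨rfl, rfl⟩ ⟨h.symm, rfl⟩
    ((F.overlap G).lift a b h) (eqToHom e.symm) (eqToHom e)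
  rw [Pt.move_eqToHom (by simp), Pt.move_eqToHom (by simp), eqToHom_trans, eqToHom_refl] at this
  rw [this, Hom.at]

/-- A natural family of 2-arrows indexed by pairs of elements. -/
structure Fam (F G : Fraction S x y) where
  val : ∀ ⦃T : K⦄ ⦃a : T ⟶ F.apex⦄ ⦃b : T ⟶ G.apex⦄
    ⦃p p' : T ⟶ x⦄ ⦃q q' : T ⟶ y⦄ (_ : F.Pt a p q) (_ : G.Pt b p' q') (_ : p ⟶ p'), q ⟶ q'
  res : ∀ ⦃R T : K⦄ (r : R ⟶ T) ⦃a : T ⟶ F.apex⦄ ⦃b : T ⟶ G.apex⦄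
    ⦃p p' : T ⟶ x⦄ ⦃q q' : T ⟶ y⦄ (P : F.Pt a p q) (Q : G.Pt b p' q') (θ : p ⟶ p'),
    r ◁ val P Q θ = val (P.res r) (Q.res r) (r ◁ θ)
  nat : ∀ ⦃T : K⦄ ⦃a a' : T ⟶ F.apex⦄ ⦃b b' : T ⟶ G.apex⦄
    ⦃p₁ p₂ p₃ p₄ : T ⟶ x⦄ ⦃q₁ q₂ q₃ q₄ : T ⟶ y⦄ (P' : F.Pt a' p₁ q₁) (P : F.Pt a p₂ q₂)
    (Q : G.Pt b p₃ q₃) (Q' : G.Pt b' p₄ q₄) (φ : p₁ ⟶ p₂) (θ : p₂ ⟶ p₃) (ψ : p₃ ⟶ p₄),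
    P'.move P φ ≫ val P Q θ ≫ Q.move Q' ψ = val P' Q' (φ ≫ θ ≫ ψ)

/-- The map of fractions with given values. -/
def ofFam (τ : Fam F G) : Hom F G where
  cell := τ.val (F.ptL G) (F.ptR G) (𝟙 _)

theorem eval_ofFam (τ : Fam F G) (P : F.Pt a p q) (Q : G.Pt b p' q') (θ : p ⟶ p') :
    (ofFam τ).eval P Q θ = τ.val P Q θ := by
  obtain ⟨R, c, l, hl, hc⟩ := exists_formula F Q
  apply StrictTwoSite.cover_ext hc
  have e1 : c ◁ θ = (c ◁ θ ≫ eqToHom hl.symm) ≫ eqToHom hl := by simp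
  rw [res_eval, τ.res, e1, eval_formula, ofFam, τ.res, τ.nat]
  simp

/-- 2-arrows may be compared after passing to a cover over which a fraction has an element. -/
theorem local_ext (X : Fraction S x z) (p₀ : T ⟶ x) {q q' : T ⟶ y} {e e' : q ⟶ q'}
    (h : ∀ ⦃R : K⦄ (c : R ⟶ T) (m : R ⟶ X.apex), X.Pt m (c ≫ p₀) (m ≫ X.right) →
      c ◁ e = c ◁ e') : e = e' := by
  obtain ⟨R, c, m, hc, hm⟩ := exists_cover X p₀
  exact StrictTwoSite.cover_ext hc (h c m hm)

theorem ext_eval₁ {z : K} (X : Fraction S x z) {t t' : Hom F G}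
    (h : ∀ ⦃T : K⦄ ⦃a : T ⟶ F.apex⦄ ⦃b : T ⟶ G.apex⦄ ⦃m : T ⟶ X.apex⦄
    ⦃p p' : T ⟶ x⦄ ⦃q q' : T ⟶ y⦄ ⦃s : T ⟶ z⦄ (P : F.Pt a p q) (Q : G.Pt b p' q')
    (_ : X.Pt m p s) (θ : p ⟶ p'), t.eval P Q θ = t'.eval P Q θ) : t = t' := by
  apply ext_eval
  intro T a b p p' q q' P Q θ
  apply local_ext X p
  intro R c m hm
  rw [res_eval, res_eval]
  exact h _ _ hm _

theorem ext_eval₂ {z z' : K} (X : Fraction S x z) (Y : Fraction S x z') {t t' : Hom F G}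
    (h : ∀ ⦃T : K⦄ ⦃a : T ⟶ F.apex⦄ ⦃b : T ⟶ G.apex⦄ ⦃m : T ⟶ X.apex⦄ ⦃n : T ⟶ Y.apex⦄
    ⦃p p' : T ⟶ x⦄ ⦃q q' : T ⟶ y⦄ ⦃s : T ⟶ z⦄ ⦃s' : T ⟶ z'⦄ (P : F.Pt a p q) (Q : G.Pt b p' q')
    (_ : X.Pt m p s) (_ : Y.Pt n p s') (θ : p ⟶ p'), t.eval P Q θ = t'.eval P Q θ) : t = t' := by
  apply ext_eval₁ X
  intro T a b m p p' q q' s P Q M θ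
  apply local_ext Y p
  intro R c n hn
  rw [res_eval, res_eval]
  exact h _ _ (M.res c) hn _

theorem eval_id (P : F.Pt a p q) {b : T ⟶ F.apex} (Q : F.Pt b p' q') (θ : p ⟶ p') :
    (Hom.id F).eval P Q θ = P.move Q θ := by
  let τ : Fam F F := ⟨fun T a b p p' q q' P Q θ ↦ P.move Q θ, by
    intros; apply Pt.res_move, by intros; simp⟩
  have : Hom.id F = ofFam τ := by
    ext
    simp [Hom.id, ofFam, τ, Pt.move]
  rw [this, eval_ofFam]

theorem comp_aux {F₁ F₂ F₃ : Fraction S x y} (t₁ : Hom F₁ F₂) (t₂ : Hom F₂ F₃) {a : T ⟶ F₁.apex}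
    {b : T ⟶ F₃.apex} (P : F₁.Pt a p q) (Q : F₃.Pt b p' q') (θ : p ⟶ p') :
    ∃! e : q ⟶ q', ∀ ⦃R : K⦄ (r : R ⟶ T) (m : R ⟶ F₂.apex) (p₀ : R ⟶ x) (q₀ : R ⟶ y)
      (M : F₂.Pt m p₀ q₀) (θ₁ : r ≫ p ⟶ p₀) (θ₂ : p₀ ⟶ r ≫ p'), θ₁ ≫ θ₂ = r ◁ θ →
      r ◁ e = t₁.eval (P.res r) M θ₁ ≫ t₂.eval M (Q.res r) θ₂ := by
  have key : ∀ {T : K} {p p' : T ⟶ x} {q q' : T ⟶ y} {a : T ⟶ F₁.apex} {b : T ⟶ F₃.apex}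
      (P : F₁.Pt a p q) (Q : F₃.Pt b p' q') {m m' : T ⟶ F₂.apex} {p₀ p₁ : T ⟶ x} {q₀ q₁ : T ⟶ y}
      (M : F₂.Pt m p₀ q₀) (M' : F₂.Pt m' p₁ q₁) (θ₁ : p ⟶ p₀) (θ₂ : p₀ ⟶ p') (θ₁' : p ⟶ p₁)
      (θ₂' : p₁ ⟶ p') [IsIso θ₂'], θ₁ ≫ θ₂ = θ₁' ≫ θ₂' →
      t₁.eval P M θ₁ ≫ t₂.eval M Q θ₂ = t₁.eval P M' θ₁' ≫ t₂.eval M' Q θ₂' := by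
    intro T p p' q q' a b P Q m m' p₀ p₁ q₀ q₁ M M' θ₁ θ₂ θ₁' θ₂' _ h
    obtain rfl : θ₁' = θ₁ ≫ θ₂ ≫ inv θ₂' := by simp [← Category.assoc, h]
    rw [← eval_move t₁ P M M M' θ₁ (θ₂ ≫ inv θ₂'), Category.assoc, move_eval]
    simp
  have hres : ∀ {R R' : K} (k : R' ⟶ R) (r : R ⟶ T) {m : R ⟶ F₂.apex} {p₀ : R ⟶ x} {q₀ : R ⟶ y}
      (M : F₂.Pt m p₀ q₀) (θ₁ : r ≫ p ⟶ p₀) (θ₂ : p₀ ⟶ r ≫ p'),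
      (α_ k r q).hom ≫ k ◁ (t₁.eval (P.res r) M θ₁ ≫ t₂.eval M (Q.res r) θ₂) ≫ (α_ k r q').inv =
      t₁.eval (P.res (k ≫ r)) (M.res k) ((α_ k r p).hom ≫ k ◁ θ₁) ≫
        t₂.eval (M.res k) (Q.res (k ≫ r)) (k ◁ θ₂ ≫ (α_ k r p').inv) := by
    intro R R' k r m p₀ q₀ M θ₁ θ₂
    rw [← move_eval t₁ (P.res (k ≫ r)) ((P.res r).res k) ((P.res r).res k),
      ← eval_move t₂ (M.res k) ((Q.res r).res k) ((Q.res r).res k) (Q.res (k ≫ r)), ← res_eval k t₁ (P.res r) M,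
      ← res_eval k t₂ M (Q.res r)]
    simp [Pt.move_eqToHom]
  have := S.glue (f := q) (g := q') (fun R r e ↦ ∃ (m : R ⟶ F₂.apex) (p₀ : R ⟶ x) (q₀ : R ⟶ y)
      (M : F₂.Pt m p₀ q₀) (θ₁ : r ≫ p ⟶ p₀) (θ₂ : p₀ ⟶ r ≫ p'), θ₁ ≫ θ₂ = r ◁ θ ∧
      e = t₁.eval (P.res r) M θ₁ ≫ t₂.eval M (Q.res r) θ₂) ?_ ?_ ?_
  · obtain ⟨e, he, hu⟩ := this
    exact ⟨e, fun R r m p₀ q₀ M θ₁ θ₂ h ↦ he r _ ⟨m, p₀, q₀, M, θ₁, θ₂, h, rfl⟩,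
      fun e' he' ↦ hu e' fun R r a ⟨m, p₀, q₀, M, θ₁, θ₂, h, ha⟩ ↦
        (he' r m p₀ q₀ M θ₁ θ₂ h).trans ha.symm⟩
  · rintro R r _ _ ⟨m, p₀, q₀, M, θ₁, θ₂, h, rfl⟩ ⟨m', p₁, q₁, M', θ₁', θ₂', h', rfl⟩
    apply local_ext F₂ (r ≫ p')
    intro R' c n N
    refine (cancel_mono (α_ c r q').inv).1 ((cancel_epi (α_ c r q).hom).1 ?_)
    rw [hres, hres, key _ _ (M.res c) N _ _ ((c ≫ r) ◁ θ ≫ (α_ _ _ _).hom) (α_ _ _ _).inv,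
      key _ _ (M'.res c) N _ _ ((c ≫ r) ◁ θ ≫ (α_ _ _ _).hom) (α_ _ _ _).inv]
    · rw [comp_whiskerLeft, ← h']; simp
    · rw [comp_whiskerLeft, ← h]; simp
  · rintro R R' k r _ ⟨m, p₀, q₀, M, θ₁, θ₂, h, rfl⟩
    exact ⟨_, _, _, M.res k, (α_ k r p).hom ≫ k ◁ θ₁, k ◁ θ₂ ≫ (α_ k r p').inv, by
      rw [comp_whiskerLeft, ← h]; simp, hres ..⟩
  · obtain ⟨R, c, m, hc, M⟩ := exists_cover F₂ p'
    exact ⟨R, c, _, hc, m, _, _, M, c ◁ θ, 𝟙 _, by simp, rfl⟩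

theorem eval_congr (t : Hom F G) {a₁ : T ⟶ F.apex} {b₁ : T ⟶ G.apex} {p₁ p₁' : T ⟶ x}
    {q₁ q₁' : T ⟶ y} (P : F.Pt a p q) (P₁ : F.Pt a₁ p₁ q₁) (Q : G.Pt b p' q') (Q₁ : G.Pt b₁ p₁' q₁')
    (ha : a = a₁) (hb : b = b₁) (θ : p ⟶ p') :
    t.eval P Q θ = eqToHom (by rw [← P.ho, ha, P₁.ho]) ≫
      t.eval P₁ Q₁ (eqToHom (by rw [← P.hb, ha, P₁.hb]) ≫ θ ≫
        eqToHom (by rw [← Q.hb, hb, Q₁.hb])) ≫ eqToHom (by rw [← Q.ho, hb, Q₁.ho]) := by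
  subst ha hb
  obtain ⟨rfl, rfl⟩ := P
  obtain ⟨rfl, rfl⟩ := P₁
  obtain ⟨rfl, rfl⟩ := Q
  obtain ⟨rfl, rfl⟩ := Q₁
  simp

theorem eval_at' (t : Hom F G) {a₁ : T ⟶ F.apex} {b₁ : T ⟶ G.apex} (h : a ≫ F.left = b ≫ G.left)
    (P : F.Pt a₁ p q) (Q : G.Pt b₁ p' q') (ha : a = a₁) (hb : b = b₁) :
    t.at a b h = eqToHom (by rw [ha, P.ho]) ≫
      t.eval P Q (eqToHom (by rw [← P.hb, ← ha, h, hb, Q.hb])) ≫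
      eqToHom (by rw [hb, Q.ho]) := by
  rw [eval_at, eval_congr t _ P _ Q ha hb]
  simp

section

variable {F₁ F₂ F₃ : Fraction S x y} (t₁ : Hom F₁ F₂) (t₂ : Hom F₂ F₃) {a : T ⟶ F₁.apex}
  {b : T ⟶ F₃.apex} {m : T ⟶ F₂.apex}

/-- Values of a vertical composite. -/
noncomputable def cval (P : F₁.Pt a p q) (Q : F₃.Pt b p' q') (θ : p ⟶ p') : q ⟶ q' :=
  (comp_aux t₁ t₂ P Q θ).choose

theorem cval_formula (P : F₁.Pt a p q) (M : F₂.Pt m p' q') (Q : F₃.Pt b p'' q'')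
    (θ : p ⟶ p') (θ' : p' ⟶ p'') :
    cval t₁ t₂ P Q (θ ≫ θ') = t₁.eval P M θ ≫ t₂.eval M Q θ' := by
  have h := (comp_aux t₁ t₂ P Q (θ ≫ θ')).choose_spec.1 (𝟙 T) m p' q' M ((λ_ _).hom ≫ θ)
    (θ' ≫ (λ_ _).inv) (by simp)
  rw [← move_eval _ _ P P, ← eval_move _ _ Q Q, Strict.leftUnitor_eqToIso,
    Strict.leftUnitor_eqToIso, eqToIso.hom, eqToIso.inv, Pt.move_eqToHom (Strict.id_comp a),
    Pt.move_eqToHom (Strict.id_comp b).symm, id_whiskerLeft, Strict.leftUnitor_eqToIso,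
    Strict.leftUnitor_eqToIso, eqToIso.hom, eqToIso.inv, Category.assoc, cancel_epi] at h
  refine (cancel_mono (eqToHom (Strict.id_comp q'').symm)).1 ?_
  rw [Category.assoc]
  exact h

theorem res_cval (r : R ⟶ T) (P : F₁.Pt a p q) (Q : F₃.Pt b p' q') (θ : p ⟶ p') :
    r ◁ cval t₁ t₂ P Q θ = cval t₁ t₂ (P.res r) (Q.res r) (r ◁ θ) := by
  refine (comp_aux t₁ t₂ (P.res r) (Q.res r) (r ◁ θ)).choose_spec.2 _ ?_
  intro R' k m p₀ q₀ M θ₁ θ₂ h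
  have : (k ≫ r) ◁ cval t₁ t₂ P Q θ = _ :=
    (comp_aux t₁ t₂ P Q θ).choose_spec.1 (k ≫ r) m p₀ q₀ M ((α_ _ _ _).hom ≫ θ₁)
    (θ₂ ≫ (α_ _ _ _).inv) (by rw [comp_whiskerLeft, ← h]; simp)
  rw [comp_whiskerLeft, ← move_eval _ _ ((P.res r).res k) ((P.res r).res k),
    ← eval_move _ _ ((Q.res r).res k) ((Q.res r).res k)] at this
  simp only [Strict.associator_eqToIso, eqToIso.hom, eqToIso.inv] at this
  rw [Pt.move_eqToHom (Strict.assoc _ _ _), Pt.move_eqToHom (Strict.assoc _ _ _).symm] at this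
  refine (cancel_epi (eqToHom (Strict.assoc k r q))).1
    ((cancel_mono (eqToHom (Strict.assoc k r q').symm)).1 ?_)
  simpa using this

theorem eval_comp (P : F₁.Pt a p q) (M : F₂.Pt m p' q') (Q : F₃.Pt b p'' q'')
    (θ : p ⟶ p') (θ' : p' ⟶ p'') :
    (Hom.comp t₁ t₂).eval P Q (θ ≫ θ') = t₁.eval P M θ ≫ t₂.eval M Q θ' := by
  let τ : Fam F₁ F₃ := ⟨fun T a b p p' q q' P Q θ ↦ cval t₁ t₂ P Q θ, by
    intros; apply res_cval, by
    intro T a a' b b' p₁ p₂ p₃ p₄ q₁ q₂ q₃ q₄ P' P Q Q' φ θ ψ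
    apply local_ext F₂ p₂
    intro R c m M
    rw [whiskerLeft_comp, whiskerLeft_comp, res_cval, res_cval, Pt.res_move, Pt.res_move,
      ← Category.id_comp (c ◁ θ), cval_formula t₁ t₂ (P.res c) M (Q.res c), whiskerLeft_comp,
      cval_formula t₁ t₂ (P'.res c) M (Q'.res c)]
    simp⟩
  have : Hom.comp t₁ t₂ = ofFam τ := by
    ext
    apply StrictTwoSite.cover_ext
      (S.pullback_mem F₂.left F₂.left_mem ((F₁.overlap F₃).fst ≫ F₁.left))
    dsimp only [Hom.comp, ofFam, τ]
    rw [StrictTwoSite.whisker_desc, res_cval]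
    let Q := S.pullback F₂.left F₂.left_mem ((F₁.overlap F₃).fst ≫ F₁.left)
    have M : F₂.Pt Q.snd (Q.fst ≫ (F₁.overlap F₃).fst ≫ F₁.left) (Q.snd ≫ F₂.right) :=
      ⟨Q.w.symm, rfl⟩
    rw [← Category.comp_id (_ ◁ 𝟙 _), cval_formula t₁ t₂ _ M, eval_at, eval_at,
      eval_congr t₁ _ ((F₁.ptL F₃).res _) _ M rfl rfl,
      eval_congr t₂ _ M _ ((F₁.ptR F₃).res _) rfl rfl]
    simp
    rfl
  rw [this, eval_ofFam]
  exact cval_formula ..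

end

end Hom

namespace Pt

variable {F : Fraction S x y} {G : Fraction S y z} {T R : K} {p p' : T ⟶ x} {q q' : T ⟶ z}
  {c d : T ⟶ (F.comp G).apex}

/-- The first component of an element of a composite fraction. -/
theorem l (C : (F.comp G).Pt c p q) :
    F.Pt (c ≫ (S.pullback G.left G.left_mem F.right).fst) p
      ((c ≫ (S.pullback G.left G.left_mem F.right).fst) ≫ F.right) :=
  ⟨(Strict.assoc _ _ _).trans C.hb, rfl⟩

/-- The second component of an element of a composite fraction. -/
theorem r (C : (F.comp G).Pt c p q) :
    G.Pt (c ≫ (S.pullback G.left G.left_mem F.right).snd)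
      ((c ≫ (S.pullback G.left G.left_mem F.right).fst) ≫ F.right) q :=
  ⟨((S.pullback G.left G.left_mem F.right).comp_w c).symm, (Strict.assoc _ _ _).trans C.ho⟩

theorem move_comp (C : (F.comp G).Pt c p q) (D : (F.comp G).Pt d p' q') (θ : p ⟶ p') :
    C.move D θ = C.r.move D.r (C.l.move D.l θ) := by
  obtain ⟨s, hs⟩ := exists_lift C D θ
  let A := S.pullback G.left G.left_mem F.right
  have hs' : s ▷ (A.fst ≫ F.left) = _ := hs
  have e1 : C.l.move D.l θ = (s ▷ A.fst) ▷ F.right := by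
    rw [move_eq (s ▷ A.fst)]
    · simp [A]
    · rw [whiskerRight_comp, Strict.associator_eqToIso, Strict.associator_eqToIso] at hs'
      refine (cancel_epi (eqToHom (Strict.assoc _ _ _).symm)).1
        ((cancel_mono (eqToHom (Strict.assoc _ _ _))).1 ?_)
      simpa using hs'
  have e2 : (s ▷ A.fst) ▷ F.right = eqToHom (A.comp_w c) ≫ (s ▷ A.snd) ▷ G.left ≫
      eqToHom (A.comp_w d).symm := by
    have h1 := whiskerRight_comp s A.fst F.right
    have h2 := whiskerRight_comp s A.snd G.left
    have h3 := whiskerRight_congr A.w s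
    rw [h1, h2] at h3
    refine (cancel_epi (eqToHom (Strict.assoc _ _ _).symm)).1
        ((cancel_mono (eqToHom (Strict.assoc _ _ _))).1 ?_)
    simpa using h3
  rw [move_eq s hs, e1, e2, move_eq (P := C.r) (Q := D.r) (s ▷ A.snd) (by simp [A])]
  change _ ≫ s ▷ (A.snd ≫ G.right) ≫ _ = _
  simp

end Pt

namespace Hom

variable {F F' F'' : Fraction S x y} {G G' : Fraction S y z} {T R : K}
  {p p' p'' : T ⟶ x} {q q' q'' : T ⟶ z}

/-- Values of a horizontal composite. -/
noncomputable def hFam (t : Hom F F') (s : Hom G G') : Fam (F.comp G) (F'.comp G') where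
  val := fun _ _ _ _ _ _ _ C D θ ↦ s.eval C.r D.r (t.eval C.l D.l θ)
  res := by
    intro R T r a b p p' q q' C D θ
    rw [res_eval, res_eval, eval_congr t (C.res r).l (C.l.res r) (D.res r).l (D.l.res r)
      (Strict.assoc _ _ _) (Strict.assoc _ _ _),
      eval_congr s (C.res r).r (C.r.res r) (D.res r).r (D.r.res r)
      (Strict.assoc _ _ _) (Strict.assoc _ _ _)]
    simp
  nat := by
    intros
    simp [Pt.move_comp]

theorem eval_whiskerRight (t : Hom F F') (G : Fraction S y z) {a : T ⟶ (F.comp G).apex}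
    {b : T ⟶ (F'.comp G).apex} (C : (F.comp G).Pt a p q) (D : (F'.comp G).Pt b p' q')
    (θ : p ⟶ p') : (t.whiskerRight G).eval C D θ = C.r.move D.r (t.eval C.l D.l θ) := by
  have : t.whiskerRight G = ofFam (hFam t (Hom.id G)) := by
    ext
    dsimp only [Hom.whiskerRight, ofFam, hFam]
    rw [eval_id, eval_at' t _ (ptL (F.comp G) (F'.comp G)).l (ptR (F.comp G) (F'.comp G)).l
      rfl rfl,
      Pt.move]
    simp
  rw [this, eval_ofFam]
  simp only [hFam, eval_id]

theorem eval_whiskerLeft (F : Fraction S x y) (t : Hom G G') {a : T ⟶ (F.comp G).apex}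
    {b : T ⟶ (F.comp G').apex} (C : (F.comp G).Pt a p q) (D : (F.comp G').Pt b p' q')
    (θ : p ⟶ p') : (t.whiskerLeft F).eval C D θ = t.eval C.r D.r (C.l.move D.l θ) := by
  have : t.whiskerLeft F = ofFam (hFam (Hom.id F) t) := by
    ext
    let A := S.pullback G.left G.left_mem F.right
    let B := S.pullback G'.left G'.left_mem F.right
    let W : StrictPullback (B.fst ≫ F.left) (A.fst ≫ F.left) := (F.comp G).overlap (F.comp G')
    let N := G.overlap G'
    have hN : S.mem (N.fst ≫ G.left) := S.comp_mem _ _ (S.pullback_mem _ _ _) G.left_mem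
    let M := S.pullback (N.fst ≫ G.left) hN F.right
    have hM : S.mem (M.fst ≫ F.left) := S.comp_mem _ _ (S.pullback_mem _ _ _) F.left_mem
    let C := S.pullback (M.fst ≫ F.left) hM (W.fst ≫ A.fst ≫ F.left)
    let mA : M.pt ⟶ A.pt := A.lift M.fst (M.snd ≫ N.fst) (by rw [M.w, Strict.assoc])
    let mB : M.pt ⟶ B.pt := B.lift M.fst (M.snd ≫ N.snd)
      (by rw [M.w, Strict.assoc, ← N.w])
    have hmA : (C.snd ≫ mA) ≫ A.fst = C.snd ≫ M.fst := by rw [Strict.assoc, A.lift_fst]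
    have hmB : (C.snd ≫ mB) ≫ B.fst = C.snd ≫ M.fst := by rw [Strict.assoc, B.lift_fst]
    have hmA' : (C.snd ≫ mA) ≫ A.snd = C.snd ≫ M.snd ≫ N.fst := by rw [Strict.assoc, A.lift_snd]
    have hmB' : (C.snd ≫ mB) ≫ B.snd = C.snd ≫ M.snd ≫ N.snd := by rw [Strict.assoc, B.lift_snd]
    have XA : (F.comp G).Pt (C.snd ≫ mA) (C.fst ≫ W.fst ≫ A.fst ≫ F.left)
        ((C.snd ≫ mA) ≫ A.snd ≫ G.right) :=
      ⟨(Strict.assoc _ _ _).symm.trans ((congrArg (· ≫ F.left) hmA).trans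
        ((Strict.assoc _ _ _).trans C.w.symm)), rfl⟩
    have XB : (F.comp G').Pt (C.snd ≫ mB) (C.fst ≫ W.fst ≫ A.fst ≫ F.left)
        ((C.snd ≫ mB) ≫ B.snd ≫ G'.right) :=
      ⟨(Strict.assoc _ _ _).symm.trans ((congrArg (· ≫ F.left) hmB).trans
        ((Strict.assoc _ _ _).trans C.w.symm)), rfl⟩
    apply StrictTwoSite.cover_ext (S.pullback_mem _ hM (W.fst ≫ A.fst ≫ F.left))
    have e := (hFam (Hom.id F) t).nat ((ptL (F.comp G) (F.comp G')).res C.fst) XA XB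
      ((ptR (F.comp G) (F.comp G')).res C.fst) (𝟙 _) (𝟙 _) (𝟙 _)
    dsimp only [Hom.whiskerLeft, ofFam]
    rw [StrictTwoSite.whisker_desc, (hFam (Hom.id F) t).res, whiskerLeft_id]
    rw [Category.id_comp, Category.id_comp] at e
    refine Eq.trans ?_ e
    dsimp only [hFam]
    rw [eval_id, ← eqToHom_refl _ rfl, Pt.move_eqToHom (hmA.trans hmB.symm),
      eval_at' t _ XA.r XB.r hmA'.symm hmB'.symm, Pt.move, Pt.move]
    simp [A, B, W, N, M, C, mA, mB]
  rw [this, eval_ofFam]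
  simp only [hFam, eval_id]

theorem push {F G : Fraction S x y} {T : K} {p : T ⟶ x} {q : T ⟶ y} {a : T ⟶ F.apex}
    (P : F.Pt a p q) (r : F.apex ⟶ G.apex) (hl : r ≫ G.left = F.left)
    (hr : F.right = r ≫ G.right) : G.Pt (a ≫ r) p q :=
  ⟨by rw [Strict.assoc, hl, P.hb], by rw [Strict.assoc, ← hr, P.ho]⟩

theorem eval_renaming {F G : Fraction S x y} {T : K} {p p' : T ⟶ x} {q q' : T ⟶ y} {a : T ⟶ F.apex}
    {b : T ⟶ G.apex} (r : F.apex ⟶ G.apex) (hl : r ≫ G.left = F.left)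
    (hr : F.right = r ≫ G.right) (P : F.Pt a p q) (Q : G.Pt b p' q') (θ : p ⟶ p') :
    (Hom.renaming r hl (eqToHom hr)).eval P Q θ = (push P r hl hr).move Q θ := by
  have hmove : ∀ {T : K} {p p' : T ⟶ x} {q q' : T ⟶ y} {a a' : T ⟶ F.apex} (P : F.Pt a p q)
      (Q : F.Pt a' p' q') (θ : p ⟶ p'), P.move Q θ = (push P r hl hr).move (push Q r hl hr) θ := by
    intro T p p' q q' a a' P Q θ
    obtain ⟨s, hs⟩ := Pt.exists_lift P Q θ
    rw [Pt.move_eq s hs, Pt.move_eq (s ▷ r)]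
    · have h1 := whiskerRight_congr hr s
      rw [h1]
      simp
    · have h1 := whiskerRight_congr hl s
      rw [hs, whiskerRight_comp] at h1
      refine (cancel_epi (eqToHom (Strict.assoc _ _ _).symm)).1
        ((cancel_mono (eqToHom (Strict.assoc _ _ _))).1 ?_)
      simp at h1
      simp [h1]
  let τ : Fam F G := ⟨fun T a b p p' q q' P Q θ ↦ (push P r hl hr).move Q θ, by
    intro R T k a b p p' q q' P Q θ
    rw [Pt.res_move, Pt.move_congr _ (push (P.res k) r hl hr) _ (Q.res k)
      (Strict.assoc _ _ _).symm rfl]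
    simp, by
    intros
    rw [hmove]
    simp⟩
  have : Hom.renaming r hl (eqToHom hr) = ofFam τ := by
    ext
    simp [Hom.renaming, ofFam, τ, Pt.move]
  rw [this, eval_ofFam]

end Hom

section Structure

variable {x₁ x₂ x₃ x₄ : K}

/-- The canonical arrow `(u ×_{x₂} v) ×_{x₃} w ⟶ u ×_{x₂} (v ×_{x₃} w)`. -/
noncomputable def assocArrow (F : Fraction S x₁ x₂) (G : Fraction S x₂ x₃) (H : Fraction S x₃ x₄) :
    ((F.comp G).comp H).apex ⟶ (F.comp (G.comp H)).apex :=
  let A := S.pullback G.left G.left_mem F.right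
  let A' := S.pullback H.left H.left_mem (A.snd ≫ G.right)
  let B := S.pullback H.left H.left_mem G.right
  let B' := S.pullback (B.fst ≫ G.left) (G.comp H).left_mem F.right
  B'.lift (A'.fst ≫ A.fst)
    (B.lift (A'.fst ≫ A.snd) A'.snd (by rw [Strict.assoc, A'.w]))
    (by rw [← Strict.assoc _ B.fst, B.lift_fst, Strict.assoc, A.w, Strict.assoc])

/-- The canonical arrow `u ×_{x₂} (v ×_{x₃} w) ⟶ (u ×_{x₂} v) ×_{x₃} w`. -/
noncomputable def assocInvArrow (F : Fraction S x₁ x₂) (G : Fraction S x₂ x₃)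
    (H : Fraction S x₃ x₄) :
    (F.comp (G.comp H)).apex ⟶ ((F.comp G).comp H).apex :=
  let A := S.pullback G.left G.left_mem F.right
  let A' := S.pullback H.left H.left_mem (A.snd ≫ G.right)
  let B := S.pullback H.left H.left_mem G.right
  let B' := S.pullback (B.fst ≫ G.left) (G.comp H).left_mem F.right
  A'.lift (A.lift B'.fst (B'.snd ≫ B.fst) (by rw [B'.w, Strict.assoc])) (B'.snd ≫ B.snd)
    (by rw [← Strict.assoc _ A.snd, A.lift_snd, Strict.assoc, B.w, Strict.assoc])

variable (F : Fraction S x₁ x₂) (G : Fraction S x₂ x₃) (H : Fraction S x₃ x₄)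

theorem assocArrow_left :
    assocArrow F G H ≫ (F.comp (G.comp H)).left = ((F.comp G).comp H).left := by
  simp [assocArrow]

theorem assocArrow_right :
    ((F.comp G).comp H).right = assocArrow F G H ≫ (F.comp (G.comp H)).right := by
  simp [assocArrow]

theorem assocInvArrow_left :
    assocInvArrow F G H ≫ ((F.comp G).comp H).left = (F.comp (G.comp H)).left := by
  simp [assocInvArrow]

theorem assocInvArrow_right :
    (F.comp (G.comp H)).right = assocInvArrow F G H ≫ ((F.comp G).comp H).right := by
  simp [assocInvArrow]

/-- The identity fraction. -/
@[reducible]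
def idFraction (S : StrictTwoSite K) (x : K) : Fraction S x x := ofArrow S (𝟙 x)

/-- The associator: the renaming map given by the canonical isomorphism of iterated pullbacks. -/
noncomputable def Hom.assoc : Hom ((F.comp G).comp H) (F.comp (G.comp H)) :=
  Hom.renaming (assocArrow F G H) (assocArrow_left F G H) (eqToHom (assocArrow_right F G H))

/-- The inverse associator. -/
noncomputable def Hom.assocInv : Hom (F.comp (G.comp H)) ((F.comp G).comp H) :=
  Hom.renaming (assocInvArrow F G H) (assocInvArrow_left F G H)
    (eqToHom (assocInvArrow_right F G H))

theorem leftUnit_left : (S.pullback F.left F.left_mem (𝟙 x₁)).snd ≫ F.left =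
    ((idFraction S x₁).comp F).left := (S.pullback F.left F.left_mem (𝟙 x₁)).w.symm

theorem leftUnitInv_left : (S.pullback F.left F.left_mem (𝟙 x₁)).lift F.left (𝟙 _)
    (by rw [Strict.comp_id, Strict.id_comp]) ≫ ((idFraction S x₁).comp F).left = F.left := by
  simp

theorem leftUnitInv_right : F.right = (S.pullback F.left F.left_mem (𝟙 x₁)).lift F.left (𝟙 _)
    (by rw [Strict.comp_id, Strict.id_comp]) ≫ ((idFraction S x₁).comp F).right := by
  simp

theorem rightUnit_right : (F.comp (idFraction S x₂)).right =
    (S.pullback (𝟙 x₂) (S.id_mem x₂) F.right).fst ≫ F.right :=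
  (S.pullback (𝟙 x₂) (S.id_mem x₂) F.right).w.symm

theorem rightUnitInv_left : (S.pullback (𝟙 x₂) (S.id_mem x₂) F.right).lift (𝟙 _) F.right
    (by rw [Strict.comp_id, Strict.id_comp]) ≫ (F.comp (idFraction S x₂)).left = F.left := by
  simp

theorem rightUnitInv_right : F.right =
    (S.pullback (𝟙 x₂) (S.id_mem x₂) F.right).lift (𝟙 _) F.right
    (by rw [Strict.comp_id, Strict.id_comp]) ≫ (F.comp (idFraction S x₂)).right := by
  simp

/-- The left unitor: the renaming map given by the projection `x ×ₓ u ⟶ u`. -/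
noncomputable def Hom.leftUnit : Hom ((idFraction S x₁).comp F) F :=
  Hom.renaming _ (leftUnit_left F) (eqToHom rfl)

/-- The inverse left unitor. -/
noncomputable def Hom.leftUnitInv : Hom F ((idFraction S x₁).comp F) :=
  Hom.renaming _ (leftUnitInv_left F) (eqToHom (leftUnitInv_right F))

/-- The right unitor: the renaming map given by the projection `u ×_y y ⟶ u`. -/
noncomputable def Hom.rightUnit : Hom (F.comp (idFraction S x₂)) F :=
  Hom.renaming _ rfl (eqToHom (rightUnit_right F))

/-- The inverse right unitor. -/
noncomputable def Hom.rightUnitInv : Hom F (F.comp (idFraction S x₂)) :=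
  Hom.renaming _ (rightUnitInv_left F) (eqToHom (rightUnitInv_right F))

namespace Hom

section

variable {F G H} {T : K} {p p' : T ⟶ x₁} {q q' : T ⟶ x₄}

theorem eval_assoc {c : T ⟶ ((F.comp G).comp H).apex} {d : T ⟶ (F.comp (G.comp H)).apex}
    (C : ((F.comp G).comp H).Pt c p q) (D : (F.comp (G.comp H)).Pt d p' q') (θ : p ⟶ p') :
    (Hom.assoc F G H).eval C D θ = C.r.move D.r.r (C.l.r.move D.r.l (C.l.l.move D.l θ)) := by
  rw [Hom.assoc, eval_renaming, Pt.move_comp, Pt.move_comp,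
    Pt.move_congr (Pt.l (push C _ (assocArrow_left F G H) (assocArrow_right F G H))) C.l.l D.l D.l (by simp [assocArrow]) rfl,
    Pt.move_congr (Pt.l (Pt.r (push C _ (assocArrow_left F G H) (assocArrow_right F G H)))) C.l.r D.r.l D.r.l (by simp [assocArrow]) rfl,
    Pt.move_congr (Pt.r (Pt.r (push C _ (assocArrow_left F G H) (assocArrow_right F G H)))) C.r D.r.r D.r.r (by simp [assocArrow]) rfl]
  simp

theorem eval_assocInv {c : T ⟶ ((F.comp G).comp H).apex} {d : T ⟶ (F.comp (G.comp H)).apex}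
    (D : (F.comp (G.comp H)).Pt d p q) (C : ((F.comp G).comp H).Pt c p' q') (θ : p ⟶ p') :
    (Hom.assocInv F G H).eval D C θ = D.r.r.move C.r (D.r.l.move C.l.r (D.l.move C.l.l θ)) := by
  rw [Hom.assocInv, eval_renaming, Pt.move_comp, Pt.move_comp,
    Pt.move_congr (Pt.l (Pt.l (push D _ (assocInvArrow_left F G H) (assocInvArrow_right F G H)))) D.l C.l.l C.l.l (by simp [assocInvArrow]) rfl,
    Pt.move_congr (Pt.r (Pt.l (push D _ (assocInvArrow_left F G H) (assocInvArrow_right F G H)))) D.r.l C.l.r C.l.r (by simp [assocInvArrow]) rfl,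
    Pt.move_congr (Pt.r (push D _ (assocInvArrow_left F G H) (assocInvArrow_right F G H))) D.r.r C.r C.r (by simp [assocInvArrow]) rfl]
  simp

end

theorem move_idFraction {T : K} {a a' : T ⟶ (idFraction S x).apex} {p q p' q' : T ⟶ x}
    (P : (idFraction S x).Pt a p q)
    (Q : (idFraction S x).Pt a' p' q') (θ : p ⟶ p') :
    P.move Q θ = eqToHom (P.ho.symm.trans P.hb) ≫ θ ≫ eqToHom (Q.hb.symm.trans Q.ho) := by
  obtain ⟨h1, rfl⟩ := P
  obtain ⟨h2, rfl⟩ := Q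
  obtain ⟨s, hs⟩ := Pt.exists_lift (F := idFraction S x) ⟨h1, rfl⟩ ⟨h2, rfl⟩ θ
  rw [Pt.move_eq s hs]
  exact (by simp [hs])

section

variable {F} {T : K} {p p' : T ⟶ x₁} {q q' : T ⟶ x₂}

theorem eval_leftUnit {c : T ⟶ ((idFraction S x₁).comp F).apex} {d : T ⟶ F.apex}
    (C : ((idFraction S x₁).comp F).Pt c p q) (D : F.Pt d p' q') (θ : p ⟶ p') :
    (Hom.leftUnit F).eval C D θ = C.r.move D (eqToHom C.l.hb ≫ θ) := by
  rw [Hom.leftUnit, eval_renaming, Pt.move_congr _ C.r D D rfl rfl]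
  simp

theorem eval_leftUnitInv {c : T ⟶ ((idFraction S x₁).comp F).apex} {d : T ⟶ F.apex}
    (D : F.Pt d p q) (C : ((idFraction S x₁).comp F).Pt c p' q') (θ : p ⟶ p') :
    (Hom.leftUnitInv F).eval D C θ = D.move C.r (θ ≫ eqToHom C.l.hb.symm) := by
  rw [Hom.leftUnitInv, eval_renaming, Pt.move_comp, move_idFraction]
  refine (Pt.move_congr (Pt.r (F := idFraction S x₁) (G := F)
    (push D _ (leftUnitInv_left F) (leftUnitInv_right F))) D C.r C.r
    (by simp) rfl _).trans ?_
  simp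

theorem eval_rightUnit {c : T ⟶ (F.comp (idFraction S x₂)).apex} {d : T ⟶ F.apex}
    (C : (F.comp (idFraction S x₂)).Pt c p q) (D : F.Pt d p' q') (θ : p ⟶ p') :
    (Hom.rightUnit F).eval C D θ = eqToHom (C.r.ho.symm.trans C.r.hb) ≫ C.l.move D θ := by
  rw [Hom.rightUnit, eval_renaming, Pt.move_congr _ C.l D D rfl rfl]
  simp

theorem eval_rightUnitInv {c : T ⟶ (F.comp (idFraction S x₂)).apex} {d : T ⟶ F.apex}
    (D : F.Pt d p q) (C : (F.comp (idFraction S x₂)).Pt c p' q') (θ : p ⟶ p') :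
    (Hom.rightUnitInv F).eval D C θ = D.move C.l θ ≫ eqToHom (C.r.hb.symm.trans C.r.ho) := by
  rw [Hom.rightUnitInv, eval_renaming, Pt.move_comp, move_idFraction]
  have := Pt.move_congr (Pt.l (F := F) (G := idFraction S x₂)
    (push D _ (rightUnitInv_left F) (rightUnitInv_right F))) D C.l C.l
    (by simp) rfl θ
  refine (congrArg (_ ≫ · ≫ _) this).trans ?_
  simp

end

end Hom


namespace Hom

section

variable {y z : K} {F G H I : Fraction S x y} {T : K} {p p' : T ⟶ x} {q q' q'' : T ⟶ y}

theorem eval_comp_left (t : Hom F G) (s : Hom G H) {a : T ⟶ F.apex} {m : T ⟶ G.apex}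
    {b : T ⟶ H.apex} (P : F.Pt a p q) (M : G.Pt m p q') (Q : H.Pt b p' q'') (θ : p ⟶ p') :
    (t.comp s).eval P Q θ = t.eval P M (𝟙 p) ≫ s.eval M Q θ := by
  rw [← eval_comp, Category.id_comp]

theorem eval_comp_right (t : Hom F G) (s : Hom G H) {a : T ⟶ F.apex} {m : T ⟶ G.apex}
    {b : T ⟶ H.apex} (P : F.Pt a p q) (M : G.Pt m p' q') (Q : H.Pt b p' q'') (θ : p ⟶ p') :
    (t.comp s).eval P Q θ = t.eval P M θ ≫ s.eval M Q (𝟙 p') := by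
  rw [← eval_comp, Category.comp_id]

theorem ext_eval₃ {z z' z'' : K} (X : Fraction S x z) (Y : Fraction S x z') (Z : Fraction S x z'')
    {t t' : Hom F G}
    (h : ∀ ⦃T : K⦄ ⦃a : T ⟶ F.apex⦄ ⦃b : T ⟶ G.apex⦄ ⦃m : T ⟶ X.apex⦄ ⦃n : T ⟶ Y.apex⦄
    ⦃k : T ⟶ Z.apex⦄ ⦃p p' : T ⟶ x⦄ ⦃q q' : T ⟶ y⦄ ⦃s : T ⟶ z⦄ ⦃s' : T ⟶ z'⦄ ⦃s'' : T ⟶ z''⦄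
    (P : F.Pt a p q) (Q : G.Pt b p' q') (_ : X.Pt m p s) (_ : Y.Pt n p s') (_ : Z.Pt k p s'')
    (θ : p ⟶ p'), t.eval P Q θ = t'.eval P Q θ) : t = t' := by
  apply ext_eval₂ X Y
  intro T a b m n p p' q q' s s' P Q M N θ
  apply local_ext Z p
  intro R c k hk
  rw [res_eval, res_eval]
  exact h _ _ (M.res c) (N.res c) hk _

theorem id_comp (t : Hom F G) : (Hom.id F).comp t = t := by
  apply ext_eval
  intro T a b p p' q q' P Q θ
  rw [eval_comp_left _ _ P P, eval_id, Pt.move_id, Category.id_comp]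

theorem comp_id (t : Hom F G) : t.comp (Hom.id G) = t := by
  apply ext_eval
  intro T a b p p' q q' P Q θ
  rw [eval_comp_right _ _ P Q, eval_id, Pt.move_id, Category.comp_id]

theorem comp_assoc (t : Hom F G) (s : Hom G H) (r : Hom H I) :
    (t.comp s).comp r = t.comp (s.comp r) := by
  apply ext_eval₂ G H
  intro T a b m n p p' q q' k k' P Q M N θ
  rw [eval_comp_left _ _ P N, eval_comp_left _ _ P M, eval_comp_left _ _ P M,
    eval_comp_left _ _ M N, Category.assoc]

end

variable {x₁ x₂ x₃ x₄ x₅ : K}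

theorem whiskerLeft_id (F : Fraction S x₁ x₂) (G : Fraction S x₂ x₃) :
    (Hom.id G).whiskerLeft F = Hom.id (F.comp G) := by
  apply ext_eval
  intro T a b p p' q q' C D θ
  rw [eval_whiskerLeft, eval_id, eval_id, Pt.move_comp]

theorem whiskerLeft_comp (F : Fraction S x₁ x₂) {G H I : Fraction S x₂ x₃} (t : Hom G H)
    (s : Hom H I) : (t.comp s).whiskerLeft F = (t.whiskerLeft F).comp (s.whiskerLeft F) := by
  apply ext_eval₁ (F.comp H)
  intro T a b m p p' q q' k C D M θ
  rw [eval_comp_left _ _ C M, eval_whiskerLeft, eval_whiskerLeft, eval_whiskerLeft,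
    ← eval_comp]
  simp

theorem id_whiskerLeft {F G : Fraction S x₁ x₂} (t : Hom F G) :
    t.whiskerLeft (idFraction S x₁) =
      (Hom.leftUnit F).comp (t.comp (Hom.leftUnitInv G)) := by
  apply ext_eval
  intro T a b p p' q q' C D θ
  have e : θ = eqToHom C.l.hb.symm ≫ eqToHom C.l.hb ≫ θ := by simp
  have e' : eqToHom C.l.hb ≫ θ = (eqToHom C.l.hb ≫ θ ≫ eqToHom D.l.hb.symm) ≫ eqToHom D.l.hb := by
    simp
  rw [eval_whiskerLeft, move_idFraction]
  conv_rhs => rw [e, eval_comp _ _ C C.r, e', eval_comp _ _ C.r D.r]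
  rw [eval_leftUnit, eval_leftUnitInv]
  simp

theorem comp_whiskerLeft (F : Fraction S x₁ x₂) (G : Fraction S x₂ x₃) {H H' : Fraction S x₃ x₄}
    (t : Hom H H') : t.whiskerLeft (F.comp G) =
      (Hom.assoc F G H).comp (((t.whiskerLeft G).whiskerLeft F).comp (Hom.assocInv F G H')) := by
  apply ext_eval₂ (F.comp (G.comp H)) (F.comp (G.comp H'))
  intro T a b m n p p' q q' s s' C D M N θ
  rw [eval_comp_left _ _ C M, eval_comp_left _ _ M N]
  simp [eval_whiskerLeft, eval_assoc, eval_assocInv, Pt.move_comp]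

theorem id_whiskerRight (F : Fraction S x₁ x₂) (G : Fraction S x₂ x₃) :
    (Hom.id F).whiskerRight G = Hom.id (F.comp G) := by
  apply ext_eval
  intro T a b p p' q q' C D θ
  rw [eval_whiskerRight, eval_id, eval_id, Pt.move_comp]

theorem comp_whiskerRight {F G H : Fraction S x₁ x₂} (t : Hom F G) (s : Hom G H)
    (I : Fraction S x₂ x₃) :
    (t.comp s).whiskerRight I = (t.whiskerRight I).comp (s.whiskerRight I) := by
  apply ext_eval₁ (G.comp I)
  intro T a b m p p' q q' k C D M θ
  rw [eval_comp_left _ _ C M, eval_whiskerRight, eval_whiskerRight, eval_whiskerRight,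
    eval_comp_left _ _ C.l M.l]
  simp

theorem whiskerRight_id {F G : Fraction S x₁ x₂} (t : Hom F G) :
    t.whiskerRight (idFraction S x₂) =
      (Hom.rightUnit F).comp (t.comp (Hom.rightUnitInv G)) := by
  apply ext_eval
  intro T a b p p' q q' C D θ
  rw [eval_whiskerRight, move_idFraction, eval_comp_left _ _ C C.l, eval_comp_right _ _ C.l D.l,
    eval_rightUnit, eval_rightUnitInv]
  simp

theorem whiskerRight_comp {F F' : Fraction S x₁ x₂} (t : Hom F F') (G : Fraction S x₂ x₃)
    (H : Fraction S x₃ x₄) : t.whiskerRight (G.comp H) =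
      (Hom.assocInv F G H).comp (((t.whiskerRight G).whiskerRight H).comp (Hom.assoc F' G H)) := by
  apply ext_eval₂ ((F.comp G).comp H) ((F'.comp G).comp H)
  intro T a b m n p p' q q' s s' C D M N θ
  rw [eval_comp_left _ _ C M, eval_comp_left _ _ M N]
  simp [eval_whiskerRight, eval_assoc, eval_assocInv, Pt.move_comp]

theorem whisker_assoc (F : Fraction S x₁ x₂) {G G' : Fraction S x₂ x₃} (t : Hom G G')
    (H : Fraction S x₃ x₄) : (t.whiskerLeft F).whiskerRight H =
      (Hom.assoc F G H).comp (((t.whiskerRight H).whiskerLeft F).comp (Hom.assocInv F G' H)) := by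
  apply ext_eval₂ (F.comp (G.comp H)) (F.comp (G'.comp H))
  intro T a b m n p p' q q' s s' C D M N θ
  rw [eval_comp_left _ _ C M, eval_comp_left _ _ M N]
  simp [eval_whiskerRight, eval_whiskerLeft, eval_assoc, eval_assocInv]

theorem whisker_exchange {F G : Fraction S x₁ x₂} {H I : Fraction S x₂ x₃} (t : Hom F G)
    (s : Hom H I) : (s.whiskerLeft F).comp (t.whiskerRight I) =
      (t.whiskerRight H).comp (s.whiskerLeft G) := by
  apply ext_eval₂ (F.comp I) (G.comp H)
  intro T a b m n p p' q q' k k' C D M N θ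
  rw [eval_comp_left _ _ C M, eval_comp_left _ _ C N]
  simp [eval_whiskerRight, eval_whiskerLeft]

theorem pentagon (F : Fraction S x₁ x₂) (G : Fraction S x₂ x₃) (H : Fraction S x₃ x₄)
    (I : Fraction S x₄ x₅) :
    ((Hom.assoc F G H).whiskerRight I).comp
      ((Hom.assoc F (G.comp H) I).comp ((Hom.assoc G H I).whiskerLeft F)) =
    (Hom.assoc (F.comp G) H I).comp (Hom.assoc F G (H.comp I)) := by
  apply ext_eval₃ ((F.comp (G.comp H)).comp I) (F.comp ((G.comp H).comp I))
    ((F.comp G).comp (H.comp I))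
  intro T a b m n k p p' q q' s s' s'' C D M N L θ
  rw [eval_comp_left _ _ C M, eval_comp_left _ _ M N, eval_comp_left _ _ C L]
  simp only [eval_whiskerRight, eval_whiskerLeft, eval_assoc, Pt.move_comp, Pt.move_move,
    Category.id_comp]

theorem triangle (F : Fraction S x₁ x₂) (G : Fraction S x₂ x₃) :
    (Hom.assoc F (idFraction S x₂) G).comp ((Hom.leftUnit G).whiskerLeft F) =
      (Hom.rightUnit F).whiskerRight G := by
  apply ext_eval₁ (F.comp ((idFraction S x₂).comp G))
  intro T a b m p p' q q' s C D M θ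
  rw [eval_comp_left _ _ C M]
  simp [eval_whiskerRight, eval_whiskerLeft, eval_assoc, eval_leftUnit, eval_rightUnit,
    move_idFraction]

theorem assoc_inv (F : Fraction S x₁ x₂) (G : Fraction S x₂ x₃) (H : Fraction S x₃ x₄) :
    (Hom.assoc F G H).comp (Hom.assocInv F G H) = Hom.id _ := by
  apply ext_eval₁ (F.comp (G.comp H))
  intro T a b m p p' q q' s C D M θ
  rw [eval_comp_left _ _ C M]
  simp [eval_assoc, eval_assocInv, eval_id, Pt.move_comp]

theorem inv_assoc (F : Fraction S x₁ x₂) (G : Fraction S x₂ x₃) (H : Fraction S x₃ x₄) :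
    (Hom.assocInv F G H).comp (Hom.assoc F G H) = Hom.id _ := by
  apply ext_eval₁ ((F.comp G).comp H)
  intro T a b m p p' q q' s C D M θ
  rw [eval_comp_left _ _ C M]
  simp [eval_assoc, eval_assocInv, eval_id, Pt.move_comp]

theorem leftUnit_inv (F : Fraction S x₁ x₂) :
    (Hom.leftUnit F).comp (Hom.leftUnitInv F) = Hom.id _ := by
  apply ext_eval₁ F
  intro T a b m p p' q q' s C D M θ
  rw [eval_comp_left _ _ C M]
  simp [eval_leftUnit, eval_leftUnitInv, eval_id, Pt.move_comp, move_idFraction]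

theorem inv_leftUnit (F : Fraction S x₁ x₂) :
    (Hom.leftUnitInv F).comp (Hom.leftUnit F) = Hom.id _ := by
  apply ext_eval₁ ((idFraction S x₁).comp F)
  intro T a b m p p' q q' s C D M θ
  rw [eval_comp_left _ _ C M]
  simp [eval_leftUnit, eval_leftUnitInv, eval_id]

theorem rightUnit_inv (F : Fraction S x₁ x₂) :
    (Hom.rightUnit F).comp (Hom.rightUnitInv F) = Hom.id _ := by
  apply ext_eval₁ F
  intro T a b m p p' q q' s C D M θ
  rw [eval_comp_left _ _ C M]
  simp [eval_rightUnit, eval_rightUnitInv, eval_id, Pt.move_comp, move_idFraction]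

theorem inv_rightUnit (F : Fraction S x₁ x₂) :
    (Hom.rightUnitInv F).comp (Hom.rightUnit F) = Hom.id _ := by
  apply ext_eval₁ (F.comp (idFraction S x₂))
  intro T a b m p p' q q' s C D M θ
  rw [eval_comp_left _ _ C M]
  simp [eval_rightUnit, eval_rightUnitInv, eval_id]

end Hom

end Structure

end Fraction

end Calculus

section FractionBicategory

variable {K : Type u} [Bicategory.{w, v} K] [Bicategory.Strict K] {S : StrictTwoSite K}

/-- The bicategory of fractions `K_J`: its objects are those of `K`. -/
structure FractionBicat (S : StrictTwoSite K) where
  /-- the underlying object -/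
  obj : K

noncomputable instance fractionCategory (x y : K) : Category.{w} (Fraction S x y) where
  Hom F G := Fraction.Hom F G
  id F := Fraction.Hom.id F
  comp t s := t.comp s
  id_comp := Fraction.Hom.id_comp
  comp_id := Fraction.Hom.comp_id
  assoc := Fraction.Hom.comp_assoc

/-- The bicategory structure on `K_J`: 1-arrows are fractions, 2-arrows are maps of fractions. -/
noncomputable instance fractionBicategory : Bicategory.{w, max u v} (FractionBicat S) where
  Hom X Y := Fraction S X.obj Y.obj
  id X := Fraction.ofArrow S (𝟙 X.obj)
  comp F G := Fraction.comp F G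
  homCategory X Y := fractionCategory X.obj Y.obj
  whiskerLeft F _ _ t := Fraction.Hom.whiskerLeft F t
  whiskerRight t H := Fraction.Hom.whiskerRight t H
  associator F G H := ⟨Fraction.Hom.assoc F G H, Fraction.Hom.assocInv F G H,
    Fraction.Hom.assoc_inv F G H, Fraction.Hom.inv_assoc F G H⟩
  leftUnitor F := ⟨Fraction.Hom.leftUnit F, Fraction.Hom.leftUnitInv F,
    Fraction.Hom.leftUnit_inv F, Fraction.Hom.inv_leftUnit F⟩
  rightUnitor F := ⟨Fraction.Hom.rightUnit F, Fraction.Hom.rightUnitInv F,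
    Fraction.Hom.rightUnit_inv F, Fraction.Hom.inv_rightUnit F⟩
  whiskerLeft_id := Fraction.Hom.whiskerLeft_id
  whiskerLeft_comp F _ _ _ t s := Fraction.Hom.whiskerLeft_comp F t s
  id_whiskerLeft := Fraction.Hom.id_whiskerLeft
  comp_whiskerLeft F G _ _ t := Fraction.Hom.comp_whiskerLeft F G t
  id_whiskerRight := Fraction.Hom.id_whiskerRight
  comp_whiskerRight := Fraction.Hom.comp_whiskerRight
  whiskerRight_id := Fraction.Hom.whiskerRight_id
  whiskerRight_comp := Fraction.Hom.whiskerRight_comp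
  whisker_assoc F _ _ t H := Fraction.Hom.whisker_assoc F t H
  whisker_exchange := Fraction.Hom.whisker_exchange
  pentagon := Fraction.Hom.pentagon
  triangle := Fraction.Hom.triangle

/-- The map of fractions given by a 2-arrow `a` of `K`: it is `a` whiskered with the projection
`x ×ₓ x ⟶ x`. -/
def ofTwoArrow (S : StrictTwoSite K) {x y : K} {f g : x ⟶ y} (a : f ⟶ g) :
    Fraction.Hom (Fraction.ofArrow S f) (Fraction.ofArrow S g) where
  cell :=
    let W : StrictPullback (𝟙 x) (𝟙 x) :=
      (Fraction.ofArrow S f).overlap (Fraction.ofArrow S g)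
    W.fst ◁ a ≫ eqToHom (by rw [← Strict.comp_id W.fst, W.w, Strict.comp_id])

/-- The data of the assignment `A_J : K ⟶ K_J` on objects, 1-arrows and 2-arrows. -/
def inclusionData (S : StrictTwoSite K) : PrelaxFunctorStruct K (FractionBicat S) where
  obj x := ⟨x⟩
  map f := Fraction.ofArrow S f
  map₂ a := ofTwoArrow S a

end FractionBicategory

end TwoSite

/-!
A map of fractions is determined by its values on pairs of generalised elements of its source and
target. A generalised element of `x ⟵ x ⟶ y`, with left leg the identity, is just an arrow into
`x`, on which a 2-arrow `α` acts by whiskering; compatibility with composites and whiskerings thus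
becomes the calculus of whiskering in `K`. Composites of such fractions have monic left legs, which
forces the comparison arrows of associators and unitors to be identities. Finally, a map between
two such fractions is a 2-arrow on `x ×ₓ x`, the two projections of which to `x` are the same
cover, so it descends uniquely to `x`.
-/

namespace TwoSite

variable {K : Type u} [Bicategory.{w, v} K] [Bicategory.Strict K] {S : StrictTwoSite K}

instance StrictPullback.mono_fst {u x y : K} {j : u ⟶ x} {f : y ⟶ x} (P : StrictPullback j f)
    [Mono j] : Mono P.fst :=
  P.isPullback.mono_fst_of_mono

variable {x y z T : K}

attribute [local simp] Strict.associator_eqToIso Strict.leftUnitor_eqToIso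
  Strict.rightUnitor_eqToIso

namespace Fraction

section EqToHom

variable {F G H : Fraction S x y} {a : T ⟶ F.apex} {b : T ⟶ H.apex} {p p' : T ⟶ x} {q q' : T ⟶ y}

theorem Pt.cast (P : F.Pt a p q) (h : F = G) :
    G.Pt (a ≫ eqToHom (congrArg apex h)) p q := by
  subst h
  simpa only [eqToHom_refl, Strict.comp_id] using P

namespace Hom

theorem eval_eqToHom_comp (h : F = G) (t : G ⟶ H) (P : F.Pt a p q) (Q : H.Pt b p' q')
    (θ : p ⟶ p') : eval (eqToHom h ≫ t) P Q θ = eval t (P.cast h) Q θ := by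
  subst h
  rw [eqToHom_refl, Category.id_comp, eval_congr t P (P.cast rfl) Q Q (Strict.comp_id a).symm rfl]
  simp

theorem eval_comp_eqToHom (t : F ⟶ G) (h : G = H) (P : F.Pt a p q) (Q : H.Pt b p' q')
    (θ : p ⟶ p') : eval (t ≫ eqToHom h) P Q θ = eval t P (Q.cast h.symm) θ := by
  subst h
  rw [eqToHom_refl, Category.comp_id, eval_congr t P P Q (Q.cast rfl) rfl (Strict.comp_id b).symm]
  simp

theorem renaming_eq_eqToHom [Mono G.left] (h : F = G) (r : F.apex ⟶ G.apex)
    (hl : r ≫ G.left = F.left) (hr : F.right = r ≫ G.right) :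
    Hom.renaming r hl (eqToHom hr) = eqToHom h := by
  subst h
  obtain rfl : r = 𝟙 F.apex := by rw [← cancel_mono F.left, hl, Strict.id_comp]
  refine ext_eval fun T a b p p' q q' P Q θ ↦ ?_
  refine Eq.trans ?_ (eval_id P Q θ).symm
  rw [eval_renaming, Pt.move_congr (push P _ hl hr) P Q Q (Strict.comp_id a) rfl]
  simp

end Hom

end EqToHom

theorem ofArrow_comp (S : StrictTwoSite K) (f : x ⟶ y) (g : y ⟶ z) :
    ofArrow S (f ≫ g) = (ofArrow S f).comp (ofArrow S g) := by
  -- `left_mem` mentions the specified pullback, so `S.pullback_id f` cannot be rewritten in place.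
  have ofArrow_eq_of_eq_ofId : ∀ (P : StrictPullback (𝟙 y) f) (hP : S.mem (P.fst ≫ 𝟙 x)),
      P = StrictPullback.ofId f → ofArrow S (f ≫ g) = ⟨P.pt, P.fst ≫ 𝟙 x, hP, P.snd ≫ g⟩ := by
    rintro _ _ rfl
    simp only [StrictPullback.ofId, Strict.comp_id]
  exact ofArrow_eq_of_eq_ofId _ _ (S.pullback_id f)

theorem overlap_ofArrow_fst_eq_snd (f g : x ⟶ y) :
    ((ofArrow S f).overlap (ofArrow S g)).fst = ((ofArrow S f).overlap (ofArrow S g)).snd := by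
  simpa only [Strict.comp_id] using ((ofArrow S f).overlap (ofArrow S g)).w

section Elements

variable {f g : x ⟶ y} {a : T ⟶ (ofArrow S f).apex} {p p' : T ⟶ x} {q q' : T ⟶ y}

theorem Pt.comp_eq (P : (ofArrow S f).Pt a p q) : p ≫ f = q := by
  rw [← P.hb, ← P.ho, Strict.comp_id]

theorem Pt.move_ofArrow {a' : T ⟶ (ofArrow S f).apex} (P : (ofArrow S f).Pt a p q)
    (Q : (ofArrow S f).Pt a' p' q') (θ : p ⟶ p') :
    P.move Q θ = eqToHom P.comp_eq.symm ≫ θ ▷ f ≫ eqToHom Q.comp_eq := by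
  obtain ⟨rfl, rfl⟩ := P
  obtain ⟨rfl, rfl⟩ := Q
  rw [Pt.move_eq (eqToHom (Strict.comp_id a).symm ≫ θ ≫ eqToHom (Strict.comp_id a')) (by simp)]
  simp

theorem Hom.eval_ofTwoArrow (α : f ⟶ g) {b : T ⟶ (ofArrow S g).apex} (P : (ofArrow S f).Pt a p q)
    (Q : (ofArrow S g).Pt b p' q') (θ : p ⟶ p') :
    (ofTwoArrow S α).eval P Q θ =
      eqToHom P.comp_eq.symm ≫ θ ▷ f ≫ p' ◁ α ≫ eqToHom Q.comp_eq := by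
  obtain ⟨l, hl⟩ : ∃ l, l ≫ ((ofArrow S f).overlap (ofArrow S g)).fst = p' :=
    ⟨_, StrictPullback.lift_fst _ p' p' rfl⟩
  have hl' : l ≫ ((ofArrow S f).overlap (ofArrow S g)).fst ≫ 𝟙 x = p' := by
    rw [Strict.comp_id, hl]
  have eval_eq := (ofTwoArrow S α).eval_formula P Q l (θ ≫ eqToHom hl'.symm) (eqToHom hl')
  simp only [Category.assoc, eqToHom_trans, eqToHom_refl, Category.comp_id] at eval_eq
  rw [eval_eq]
  simp [ofTwoArrow, Pt.move_ofArrow, congr_whiskerLeft hl.symm]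

end Elements

end Fraction

open Fraction

theorem ofTwoArrow_id (f : x ⟶ y) : ofTwoArrow S (𝟙 f) = 𝟙 (ofArrow S f) := by
  refine Hom.ext_eval fun T a b p p' q q' P Q θ ↦ ?_
  refine Eq.trans ?_ (Hom.eval_id P Q θ).symm
  simp [Hom.eval_ofTwoArrow, Pt.move_ofArrow]

theorem ofTwoArrow_comp {f g h : x ⟶ y} (α : f ⟶ g) (β : g ⟶ h) :
    ofTwoArrow S (α ≫ β) = (ofTwoArrow S α ≫ ofTwoArrow S β : ofArrow S f ⟶ ofArrow S h) := by
  refine Hom.ext_eval fun T a b p p' q q' P Q θ ↦ ?_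
  have M : (ofArrow S g).Pt p p (p ≫ g) := ⟨Strict.comp_id p, rfl⟩
  refine Eq.trans ?_ (Hom.eval_comp_left (ofTwoArrow S α) (ofTwoArrow S β) P M Q θ).symm
  simp [Hom.eval_ofTwoArrow, whisker_exchange_assoc]

/-- The action of `A_J` on 2-arrows between fixed objects, as a functor. -/
def ofArrowFunctor (S : StrictTwoSite K) (x y : K) : (x ⟶ y) ⥤ Fraction S x y where
  obj := ofArrow S
  map := ofTwoArrow S
  map_id := ofTwoArrow_id
  map_comp := ofTwoArrow_comp

theorem ofTwoArrow_eqToHom {f g : x ⟶ y} (h : f = g) :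
    ofTwoArrow S (eqToHom h) = (eqToHom (congrArg (ofArrow S) h) : ofArrow S f ⟶ ofArrow S g) :=
  eqToHom_map (ofArrowFunctor S x y) h

theorem ofTwoArrow_bijective (f g : x ⟶ y) :
    Function.Bijective (ofTwoArrow S : (f ⟶ g) → Hom (ofArrow S f) (ofArrow S g)) := by
  refine (Function.bijective_iff_existsUnique _).2 fun t ↦ ?_
  have hW : S.mem ((ofArrow S f).overlap (ofArrow S g)).fst := S.pullback_mem _ _ _
  simpa only [Hom.ext_iff, ofTwoArrow, comp_eqToHom_iff] using S.existsUnique_desc hW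
    (t.cell ≫ eqToHom (congrArg (· ≫ g) (overlap_ofArrow_fst_eq_snd f g).symm))

instance full_ofArrowFunctor : (ofArrowFunctor S x y).Full :=
  ⟨(ofTwoArrow_bijective _ _).2⟩

instance faithful_ofArrowFunctor : (ofArrowFunctor S x y).Faithful :=
  ⟨fun h ↦ (ofTwoArrow_bijective _ _).1 h⟩

theorem ofTwoArrow_whiskerLeft (f : x ⟶ y) {g g' : y ⟶ z} (α : g ⟶ g') :
    ofTwoArrow S (f ◁ α) = eqToHom (ofArrow_comp S f g) ≫
      (ofTwoArrow S α).whiskerLeft (ofArrow S f) ≫ eqToHom (ofArrow_comp S f g').symm := by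
  refine Hom.ext_eval fun T a b p p' q q' P Q θ ↦ ?_
  rw [Hom.eval_eqToHom_comp, Hom.eval_comp_eqToHom, Hom.eval_whiskerLeft, Pt.move_ofArrow,
    Hom.eval_ofTwoArrow, Hom.eval_ofTwoArrow,
    congr_whiskerLeft (Q.cast (ofArrow_comp S f g')).l.comp_eq.symm]
  simp

theorem ofTwoArrow_whiskerRight {f f' : x ⟶ y} (α : f ⟶ f') (g : y ⟶ z) :
    ofTwoArrow S (α ▷ g) = eqToHom (ofArrow_comp S f g) ≫
      (ofTwoArrow S α).whiskerRight (ofArrow S g) ≫ eqToHom (ofArrow_comp S f' g).symm := by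
  refine Hom.ext_eval fun T a b p p' q q' P Q θ ↦ ?_
  rw [Hom.eval_eqToHom_comp, Hom.eval_comp_eqToHom, Hom.eval_whiskerRight, Pt.move_ofArrow,
    Hom.eval_ofTwoArrow, Hom.eval_ofTwoArrow]
  simp

theorem ofTwoArrow_leftUnitor (f : x ⟶ y) :
    ofTwoArrow S (λ_ f).hom =
      eqToHom (ofArrow_comp S (𝟙 x) f) ≫ Hom.leftUnit (ofArrow S f) := by
  rw [Hom.leftUnit, Hom.renaming_eq_eqToHom (by rw [← ofArrow_comp, Strict.id_comp]),
    Strict.leftUnitor_eqToIso, eqToIso.hom, ofTwoArrow_eqToHom, eqToHom_trans]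

theorem ofTwoArrow_rightUnitor (f : x ⟶ y) :
    ofTwoArrow S (ρ_ f).hom =
      eqToHom (ofArrow_comp S f (𝟙 y)) ≫ Hom.rightUnit (ofArrow S f) := by
  rw [Hom.rightUnit, Hom.renaming_eq_eqToHom (by rw [← ofArrow_comp, Strict.comp_id]),
    Strict.rightUnitor_eqToIso, eqToIso.hom, ofTwoArrow_eqToHom, eqToHom_trans]

theorem ofTwoArrow_associator {x₁ x₂ x₃ x₄ : K} (f : x₁ ⟶ x₂) (g : x₂ ⟶ x₃) (h : x₃ ⟶ x₄) :
    ofTwoArrow S (α_ f g h).hom =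
      eqToHom ((ofArrow_comp S (f ≫ g) h).trans (congrArg (comp · _) (ofArrow_comp S f g))) ≫
        Hom.assoc (ofArrow S f) (ofArrow S g) (ofArrow S h) ≫
          eqToHom ((ofArrow_comp S f _).trans (congrArg _ (ofArrow_comp S g h))).symm := by
  rw [Hom.assoc, Hom.renaming_eq_eqToHom (by simp only [← ofArrow_comp, Strict.assoc]),
    Strict.associator_eqToIso, eqToIso.hom, ofTwoArrow_eqToHom, eqToHom_trans, eqToHom_trans]

/-- The strict 2-functor `A_J : K ⟶ K_J`. -/
noncomputable def inclusion (S : StrictTwoSite K) : StrictPseudofunctor K (FractionBicat S) :=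
  .mk'
    { inclusionData S with
      map₂_id := ofTwoArrow_id
      map₂_comp := ofTwoArrow_comp
      map_id := fun _ ↦ rfl
      map_comp := ofArrow_comp S
      map₂_whisker_left := fun f _ _ α ↦ ofTwoArrow_whiskerLeft f α
      map₂_whisker_right := fun α g ↦ ofTwoArrow_whiskerRight α g
      map₂_left_unitor := fun f ↦ ofTwoArrow_leftUnitor f
      map₂_right_unitor := fun f ↦ ofTwoArrow_rightUnitor f
      map₂_associator := fun f g h ↦ ofTwoArrow_associator f g h }

end TwoSite

theorem mainTheorem4 {K : Type u} [Bicategory.{w, v} K] [Bicategory.Strict K]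
    (S : TwoSite.StrictTwoSite K) :
    ∃ A : StrictPseudofunctor K (TwoSite.FractionBicat S),
      A.toPrelaxFunctorStruct = TwoSite.inclusionData S ∧
        ∀ x y : K, (A.mapFunctor x y).Full ∧ (A.mapFunctor x y).Faithful :=
  ⟨TwoSite.inclusion S, rfl, fun _ _ ↦
    ⟨TwoSite.full_ofArrowFunctor, TwoSite.faithful_ofArrowFunctor⟩⟩
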